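/- Let $V$ be a finite set, $R\subseteq V$ a nonempty set of terminals (the other vertices are called Steiner vertices), and let $c_e\ge 0$ be edge costs. A *full component* of a graph $G$ on $V$ spanning $K\subseteq R$ is a subtree of $G$ whose set of terminals is $K$, all of whose leaves are terminals and all of whose internal vertices are Steiner vertices (a single terminal counts as a full component). For every nonempty $K\subseteq R$ let $C_K$ be the minimum cost of a full component spanning $K$ ($C_K=\infty$ if there is none). Let $\mathrm{OPT}(\mathcal P)$ be the optimal value of the partition relaxation $$\min \sum_{\varnothing\ne K\subseteq R} C_K x_K \quad\text{subject to}\quad x\ge 0,\qquad \sum_{K} x_K\bigl(|\{P\in\pi : K\cap P\ne\varnothing\}|-1\bigr)\ \ge\ |\pi|-1 \ \text{ for every partition } \pi \text{ of } R .$$ When edges of a graph are contracted, a merged vertex is a terminal iff it contains a terminal; $\mathrm{mtst}(G;c)$ denotes a minimum spanning tree, with respect to $c$, of the subgraph of $G$ induced by its terminals, and also its cost. *Reduced One-Pass Heuristic.* Let $G$ be the complete graph on $V$, with $c$ satisfying the triangle inequality. Fix for each $K$ that has a full component one of minimum cost $C_K$, identified with $K$ below. Put $c'_e=c_e/\sqrt2$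 if both ends of $e$ lie in $R$, and $c'_e=c_e$ otherwise. Let $G_1=G$, $T_1=\mathrm{mtst}(G_1;c')$, $i=1$. Examine the fixed full components once each, in any order; when $K$ is examined, and if its gain $c'(T_i)-\mathrm{mtst}(G_i/K;c')-c'(K)$ is positive, let $K_i=K$, let $G_{i+1}=G_i/K$ be obtained by contracting all edges of $K$, let $T_{i+1}=\mathrm{mtst}(G_{i+1};c')$, and increase $i$ by one. With $f$ the final value of $i$, output $T_{alg}=T_f\cup\bigcup_{i=1}^{f-1}K_i$. **Theorem.** (a) For every choice of the fixed full components and every order, the heuristic has an output; and, however ties between minimum terminal spanning trees are broken, $T_{alg}$ is the edge set of a connected subgraph containing all terminals (so it contains a Steiner tree), and $$c(T_{alg})\le(2\sqrt2-1)\,\mathrm{OPT}(\mathcal P).$$ (b) Consequently the integrality gap of $(\mathcal P)$ on general graphs is at most $2\sqrt2-1\approx1.83$: for every connected graph $G$ on $V$ with arbitrary nonnegative edge costs, the minimum cost of a tree in $G$ containing all terminals is at most $(2\sqrt2-1)\,\mathrm{OPT}(\mathcal P)$. -/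

import Mathlib

open scoped NNReal ENNReal

noncomputable section

namespace SteinerTree

variable {V : Type*} [Fintype V] [DecidableEq V]

/-- The cost of a set of edges. -/
def edgeCost (c : Sym2 V → ℝ≥0) (E : Set (Sym2 V)) : ℝ≥0 :=
  ∑ e, E.indicator c e

/-- A Steiner tree of the graph `G` with terminals `R`: a subtree of `G` containing all terminals. -/
def IsSteinerTree (G : SimpleGraph V) (R : Finset V) (H : G.Subgraph) : Prop :=
  H.coe.IsTree ∧ (R : Set V) ⊆ H.verts

/-- The minimum cost of a Steiner tree (infinite if there is none). -/
def steinerOpt (G : SimpleGraph V) (c : Sym2 V → ℝ≥0) (R : Finset V) : ℝ≥0∞ :=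
  ⨅ (H : G.Subgraph) (_ : IsSteinerTree G R H), (edgeCost c H.edgeSet : ℝ≥0∞)

/-- `H` is a full component of `G` spanning the set `K` of terminals: a subtree of `G` whose set of
terminals is `K`, in which the terminals are exactly the leaves (vertices with at most one
neighbour in the tree), so that all internal vertices are Steiner vertices. -/
def IsFullComponent (G : SimpleGraph V) (R K : Finset V) (H : G.Subgraph) : Prop :=
  H.coe.IsTree ∧ H.verts ∩ (R : Set V) = (K : Set V) ∧
    ∀ v ∈ H.verts, (v ∈ R ↔ (H.neighborSet v).Subsingleton)

/-- `H` is a full component spanning `K` of minimum cost. -/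
def IsMinFullComponent (G : SimpleGraph V) (c : Sym2 V → ℝ≥0) (R K : Finset V)
    (H : G.Subgraph) : Prop :=
  IsFullComponent G R K H ∧
    ∀ H' : G.Subgraph, IsFullComponent G R K H' → edgeCost c H.edgeSet ≤ edgeCost c H'.edgeSet

/-- The hyperedges: all nonempty sets of terminals. -/
def hyperedges (R : Finset V) : Finset (Finset V) :=
  R.powerset.filter (fun K => K.Nonempty)

/-- The cost `C_K` of a hyperedge: the minimum cost of a full component spanning `K`, and infinity
if there is none. -/
def hyperedgeCost (G : SimpleGraph V) (c : Sym2 V → ℝ≥0) (R K : Finset V) : ℝ≥0∞ :=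
  ⨅ (H : G.Subgraph) (_ : IsFullComponent G R K H), (edgeCost c H.edgeSet : ℝ≥0∞)

/-- The rank contribution of the hyperedge `K` for the partition `π` of the terminals: the number
of parts that meet `K`, minus one. -/
def rankContribution {R : Finset V} (π : Finpartition R) (K : Finset V) : ℝ :=
  ((π.parts.filter (fun P => (K ∩ P).Nonempty)).card : ℝ) - 1

/-- Feasibility for the partition LP. -/
def PartitionFeasible (R : Finset V) (x : Finset V → ℝ≥0) : Prop :=
  ∀ π : Finpartition R,
    (π.parts.card : ℝ) - 1 ≤ ∑ K ∈ hyperedges R, (x K : ℝ) * rankContribution π K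

/-- The optimal value of the partition LP. Here `∞ * 0 = 0`, so a hyperedge without a full
component is allowed only with the value `0` in a solution of finite cost. -/
def partitionOpt (G : SimpleGraph V) (c : Sym2 V → ℝ≥0) (R : Finset V) : ℝ≥0∞ :=
  ⨅ (x : Finset V → ℝ≥0) (_ : PartitionFeasible R x),
    ∑ K ∈ hyperedges R, hyperedgeCost G c R K * (x K : ℝ≥0∞)

/-! ### Contraction

The graph `G / D` obtained from `G` by contracting the edges in `D` has the connected components of
the graph `(V, D)` as its vertices, and (as a multigraph) the edges of `G` as its edges. -/

/-- The vertices of `G / D`. -/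
abbrev ContractVertex (D : Set (Sym2 V)) : Type _ :=
  (SimpleGraph.fromEdgeSet D).ConnectedComponent

/-- The vertex of `G / D` into which a vertex of `G` is merged. -/
def contractMap (D : Set (Sym2 V)) (v : V) : ContractVertex D :=
  (SimpleGraph.fromEdgeSet D).connectedComponentMk v

/-- The terminals of `G / D`: the merged vertices that contain a terminal of `G`. -/
def contractTerminals (R : Finset V) (D : Set (Sym2 V)) : Set (ContractVertex D) :=
  contractMap D '' (R : Set V)

/-- `T` is (the edge set of) a spanning tree of the subgraph of `G / D` induced by the terminals of
`G / D`: its edges join terminals of `G / D`, it has no loops and no parallel edges in `G / D`, and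
it is a tree on the terminals of `G / D`. -/
def IsTerminalSpanningTree (G : SimpleGraph V) (R : Finset V) (D T : Set (Sym2 V)) : Prop :=
  T ⊆ G.edgeSet ∧
  (∀ e ∈ T, ∀ v ∈ e, contractMap D v ∈ contractTerminals R D) ∧
  (∀ e ∈ T, ¬ (Sym2.map (contractMap D) e).IsDiag) ∧
  Set.InjOn (Sym2.map (contractMap D)) T ∧
  ((SimpleGraph.fromEdgeSet (Sym2.map (contractMap D) '' T)).induce
    (contractTerminals R D)).IsTree

/-- `T` is a minimum terminal spanning tree of `G / D` for the costs `c`. -/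
def IsMinTerminalSpanningTree (G : SimpleGraph V) (c : Sym2 V → ℝ≥0) (R : Finset V)
    (D T : Set (Sym2 V)) : Prop :=
  IsTerminalSpanningTree G R D T ∧
    ∀ T', IsTerminalSpanningTree G R D T' → edgeCost c T ≤ edgeCost c T'

/-- The cost of a minimum terminal spanning tree of `G / D`, for `G` such that there is one (for
instance, `G` complete and `R` nonempty). -/
def mtst (G : SimpleGraph V) (c : Sym2 V → ℝ≥0) (R : Finset V) (D : Set (Sym2 V)) : ℝ≥0 :=
  sInf (edgeCost c '' {T | IsTerminalSpanningTree G R D T})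

/-- `drop_T (K; c) = c(T) - mtst (G / D / K; c)`, for the tree `T` in `G / D` and the full component
with edge set `E`. -/
def drop (G : SimpleGraph V) (c : Sym2 V → ℝ≥0) (R : Finset V) (D T E : Set (Sym2 V)) : ℝ :=
  (edgeCost c T : ℝ) - (mtst G c R (D ∪ E) : ℝ)

/-- `gain_T (K; c) = drop_T (K; c) - c(K)`. -/
def gain (G : SimpleGraph V) (c : Sym2 V → ℝ≥0) (R : Finset V) (D T E : Set (Sym2 V)) : ℝ :=
  drop G c R D T E - (edgeCost c E : ℝ)

open Classical in
/-- The reduced costs: terminal-terminal costs are divided by `√2`. -/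
def reducedCost (c : Sym2 V → ℝ≥0) (R : Finset V) (e : Sym2 V) : ℝ≥0 :=
  if ∀ v ∈ e, v ∈ R then c e / NNReal.sqrt 2 else c e

/-- One pass over a list of hyperedges `K`, each with its full component `F K`, with costs `c`.
`Scan G c R F D T L D' T'` says: if the edges in `D` have been contracted so far and `T` is the
current minimum terminal spanning tree of `G / D`, then examining the members of `L` one after the
other, and contracting those of positive gain, can end with the set `D'` of contracted edges and
the tree `T'`. (Minimum terminal spanning trees need not be unique, so there may be several
outcomes.) -/
inductive Scan (G : SimpleGraph V) (c : Sym2 V → ℝ≥0) (R : Finset V) (F : Finset V → G.Subgraph) :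
    Set (Sym2 V) → Set (Sym2 V) → List (Finset V) → Set (Sym2 V) → Set (Sym2 V) → Prop
  | done (D T : Set (Sym2 V)) : Scan G c R F D T [] D T
  | skip {D T D' T' : Set (Sym2 V)} {K : Finset V} {L : List (Finset V)}
      (hgain : gain G c R D T (F K).edgeSet ≤ 0)
      (hrest : Scan G c R F D T L D' T') :
      Scan G c R F D T (K :: L) D' T'
  | contract {D T T₁ D' T' : Set (Sym2 V)} {K : Finset V} {L : List (Finset V)}
      (hgain : 0 < gain G c R D T (F K).edgeSet)
      (htree : IsMinTerminalSpanningTree G c R (D ∪ (F K).edgeSet) T₁)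
      (hrest : Scan G c R F (D ∪ (F K).edgeSet) T₁ L D' T') :
      Scan G c R F D T (K :: L) D' T'

/-- `A` is a possible output of the Reduced One-Pass Heuristic when it examines the full components
`F K` in the order given by the list `L`: the union of the final minimum terminal spanning tree and
of all contracted full components. -/
def IsHeuristicOutput (G : SimpleGraph V) (c : Sym2 V → ℝ≥0) (R : Finset V)
    (F : Finset V → G.Subgraph) (L : List (Finset V)) (A : Set (Sym2 V)) : Prop :=
  ∃ T₁ D T : Set (Sym2 V),
    IsMinTerminalSpanningTree G (reducedCost c R) R ∅ T₁ ∧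
    Scan G (reducedCost c R) R F ∅ T₁ L D T ∧
    A = T ∪ D

end SteinerTree

end

namespace SteinerTree

/-! ### Classes of an edge set and how many of them meet a vertex set -/

section Classes

variable {V : Type*} {α β : Type*}

/-! The tree maintained by the heuristic is itself a dual solution of the partition LP. For a tree
`T` in `G / D` and a threshold `t`, the edges of `D` together with the tree edges of cost at most
`t` partition the terminals. Let `rankIntegral` of `K` be the integral over `t` of the rank
contribution of `K` to these partitions. For `K = R` it equals the cost of `T`. Integrating the LP
constraints shows that if `a` times the rank integral of each `K` is at most `C_K`, then `a` times
the cost of `T` is at most OPT (`edgeCost_le_partitionOpt`).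

This bound is used twice. For the final tree `a = 1` works with the reduced costs c': a rejected
component has drop at most c'(K), its rank integral is at most its drop (`rankIntegral_le_drop`),
and rank integrals only shrink under later contractions (`rankIntegral_anti`), which is why one pass
suffices; a contracted component has rank integral at most 0. Hence c'(T_f) ≤ OPT. For the initial
tree and the costs c, `a = 1/2` works by touring a component at twice its cost and shortcutting to
its terminals (`rankIntegral_le_two_mul`). Hence c'(T_1) = c(T_1)/√2 ≤ √2 OPT.

Contracted components contain no terminal-terminal edge, so they are paid for at full cost: c(D) +
c'(T_f) ≤ c'(T_1) (`Scan.spec`). With c ≤ √2 c', the output costs at most √2 c'(T_f) + c'(T_1) −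
c'(T_f) ≤ (√2 − 1) OPT + √2 OPT. General graphs reduce to this case through the metric closure. -/

theorem apply_eq_of_reachable {W : Type*} {G : SimpleGraph W} (f : W → α)
    (hf : ∀ u v, G.Adj u v → f u = f v) {a b : W} (h : G.Reachable a b) : f a = f b := by
  obtain ⟨p⟩ := h
  induction p with
  | nil => rfl
  | cons h _ ih => exact (hf _ _ h).trans ih

theorem contractMap_eq_iff {E : Set (Sym2 V)} {u v : V} :
    contractMap E u = contractMap E v ↔ (SimpleGraph.fromEdgeSet E).Reachable u v :=
  SimpleGraph.ConnectedComponent.eq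

/-- A function that is constant along the edges in `E` is constant on the classes of `E`. -/
theorem apply_eq_of_contractMap_eq {E : Set (Sym2 V)} (f : V → α)
    (hf : ∀ u v, s(u, v) ∈ E → f u = f v) {a b : V} (h : contractMap E a = contractMap E b) :
    f a = f b :=
  apply_eq_of_reachable f (fun u v huv => hf u v ((SimpleGraph.fromEdgeSet_adj E).1 huv).1)
    (contractMap_eq_iff.1 h)

theorem contractMap_eq_of_mem {E : Set (Sym2 V)} {u v : V} (h : s(u, v) ∈ E) :
    contractMap E u = contractMap E v := by
  by_cases huv : u = v
  · rw [huv]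
  · exact contractMap_eq_iff.2
      (SimpleGraph.Adj.reachable ((SimpleGraph.fromEdgeSet_adj E).2 ⟨h, huv⟩))

theorem contractMap_mono {E E' : Set (Sym2 V)} (h : E ⊆ E') {a b : V}
    (hab : contractMap E a = contractMap E b) : contractMap E' a = contractMap E' b :=
  apply_eq_of_contractMap_eq _ (fun _ _ huv => contractMap_eq_of_mem (h huv)) hab

/-- If `f` identifies all that `g` identifies on `s`, then it has no more values on `s`. -/
theorem ncard_image_le_of_factors {s : Set V} (hs : s.Finite) (g : V → α) (f : V → β)
    (h : ∀ u ∈ s, ∀ v ∈ s, g u = g v → f u = f v) : (f '' s).ncard ≤ (g '' s).ncard := by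
  rcases s.eq_empty_or_nonempty with rfl | ⟨x, hx⟩
  · simp
  have : Nonempty V := ⟨x⟩
  have : f '' s ⊆ (fun a => f (Function.invFunOn g s a)) '' (g '' s) := by
    rintro _ ⟨u, hu, rfl⟩
    refine ⟨g u, ⟨u, hu, rfl⟩, ?_⟩
    have hex : ∃ a ∈ s, g a = g u := ⟨u, hu, rfl⟩
    exact h _ (Function.invFunOn_mem hex) _ hu (Function.invFunOn_eq hex)
  exact (Set.ncard_le_ncard this ((hs.image g).image _)).trans (Set.ncard_image_le (hs.image g))

/-- The number of classes of the edge set `E` that meet `K`. -/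
noncomputable def classCount (K : Finset V) (E : Set (Sym2 V)) : ℕ :=
  (contractTerminals K E).ncard

theorem classCount_le_of_factors (K : Finset V) {E E' : Set (Sym2 V)}
    (h : ∀ u ∈ K, ∀ v ∈ K, contractMap E u = contractMap E v →
      contractMap E' u = contractMap E' v) :
    classCount K E' ≤ classCount K E :=
  ncard_image_le_of_factors K.finite_toSet _ _ h

theorem classCount_anti (K : Finset V) {E E' : Set (Sym2 V)} (h : E ⊆ E') :
    classCount K E' ≤ classCount K E :=
  classCount_le_of_factors K fun _ _ _ _ => contractMap_mono h

theorem classCount_eq_one {K : Finset V} (hK : K.Nonempty) {E : Set (Sym2 V)}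
    (h : ∀ u ∈ K, ∀ v ∈ K, contractMap E u = contractMap E v) : classCount K E = 1 := by
  obtain ⟨x, hx⟩ := hK
  refine Set.ncard_eq_one.2 ⟨contractMap E x, ?_⟩
  ext y
  constructor
  · rintro ⟨u, hu, rfl⟩
    exact h u hu x hx
  · rintro rfl
    exact ⟨x, hx, rfl⟩

theorem contractMap_eq_of_classCount {K : Finset V} {E : Set (Sym2 V)} (h : classCount K E ≤ 1)
    {u v : V} (hu : u ∈ K) (hv : v ∈ K) : contractMap E u = contractMap E v :=
  (Set.ncard_le_one (K.finite_toSet.image _)).1 h _ ⟨u, hu, rfl⟩ _ ⟨v, hv, rfl⟩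

theorem two_le_classCount {K : Finset V} {E : Set (Sym2 V)} {u v : V} (hu : u ∈ K) (hv : v ∈ K)
    (h : contractMap E u ≠ contractMap E v) : 2 ≤ classCount K E := by
  by_contra hlt
  exact h (contractMap_eq_of_classCount (by omega) hu hv)

/-- An additional edge reduces the number of classes by at most one. -/
theorem classCount_le_insert (K : Finset V) (e : Sym2 V) (E : Set (Sym2 V)) :
    classCount K E ≤ classCount K (insert e E) + 1 := by
  classical
  induction e using Sym2.ind with | _ a b
  -- Redirecting the class of `b` to that of `a` is constant along `E` and along the new edge, and
  -- the only class it can lose is that of `b`.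
  set f : V → ContractVertex E := fun x =>
    if contractMap E x = contractMap E b then contractMap E a else contractMap E x with hf
  have h1 : (f '' (K : Set V)).ncard ≤ classCount K (insert s(a, b) E) := by
    refine ncard_image_le_of_factors K.finite_toSet _ _ fun u _ v _ huv => ?_
    refine apply_eq_of_contractMap_eq f (fun x y hxy => ?_) huv
    rcases hxy with hxy | hxy
    · rw [Sym2.eq_iff] at hxy
      rcases hxy with ⟨rfl, rfl⟩ | ⟨rfl, rfl⟩ <;> simp only [hf] <;> split_ifs <;> simp_all
    · simp only [hf, contractMap_eq_of_mem hxy]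
  have h2 : contractTerminals K E ⊆ insert (contractMap E b) (f '' (K : Set V)) := by
    rintro _ ⟨u, hu, rfl⟩
    by_cases h : contractMap E u = contractMap E b
    · exact Or.inl h
    · exact Or.inr ⟨u, hu, by simp [hf, h]⟩
  have h3 := Set.ncard_le_ncard h2 ((K.finite_toSet.image _).insert _)
  exact h3.trans ((Set.ncard_insert_le _ _).trans (by omega))

/-- `m` additional edges reduce the number of classes by at most `m`. -/
theorem classCount_le_union [Finite V] (K : Finset V) (E S : Set (Sym2 V)) :
    classCount K E ≤ classCount K (E ∪ S) + S.ncard := by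
  induction S, S.toFinite using Set.Finite.induction_on with
  | empty => simp
  | @insert e S he hS ih =>
    rw [Set.ncard_insert_of_notMem he, Set.union_insert]
    have := classCount_le_insert K e (E ∪ S)
    omega

/-- If the classes of `E'` are unions of classes of `E` and one of them contains `K`, then they are
fewer than those of `E` by at least the number of those that meet `K`, minus one. -/
theorem classCount_add_le {R K : Finset V} (hKR : K ⊆ R) (hK : K.Nonempty) {E E' : Set (Sym2 V)}
    (hE : ∀ u v, contractMap E u = contractMap E v → contractMap E' u = contractMap E' v)
    (hK' : ∀ u ∈ K, ∀ v ∈ K, contractMap E' u = contractMap E' v) :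
    classCount R E' + classCount K E ≤ classCount R E + 1 := by
  obtain ⟨x, hx⟩ := hK
  -- The terminals whose class misses `K`. The classes that meet `K` all merge into that of `x`; the
  -- others cannot become more numerous.
  set s : Set V := {v | v ∈ R ∧ contractMap E v ∉ contractTerminals K E}
  have hsfin : s.Finite := R.finite_toSet.subset fun v hv => hv.1
  have h1 : contractTerminals R E' ⊆ insert (contractMap E' x) (contractMap E' '' s) := by
    rintro _ ⟨v, hv, rfl⟩
    by_cases h : contractMap E v ∈ contractTerminals K E
    · obtain ⟨u, hu, huv⟩ := h
      exact Or.inl ((hE _ _ huv).symm.trans (hK' u hu x hx))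
    · exact Or.inr ⟨v, ⟨hv, h⟩, rfl⟩
  have h2 : (contractMap E' '' s).ncard ≤ (contractMap E '' s).ncard :=
    ncard_image_le_of_factors hsfin _ _ fun u _ v _ => hE u v
  have h3 : contractMap E '' s = contractTerminals R E \ contractTerminals K E := by
    ext y
    constructor
    · rintro ⟨v, hv, rfl⟩
      exact ⟨⟨v, hv.1, rfl⟩, hv.2⟩
    · rintro ⟨⟨v, hv, rfl⟩, hv'⟩
      exact ⟨v, ⟨hv, hv'⟩, rfl⟩
  have h4 : contractTerminals K E ⊆ contractTerminals R E :=
    Set.image_mono (by exact_mod_cast hKR)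
  have h5 := Set.ncard_sdiff_add_ncard_of_subset h4 (R.finite_toSet.image _)
  have h6 := Set.ncard_le_ncard h1 ((hsfin.image _).insert _)
  have h7 := Set.ncard_insert_le (contractMap E' x) (contractMap E' '' s)
  rw [h3] at h2
  unfold classCount
  omega

end Classes

/-! ### Terminal spanning trees by counting classes -/

section SpanningTrees

variable {V : Type*}

/-- Both ends of `e` are merged into terminals of `G / D`. -/
def JoinsTerminals (R : Finset V) (D : Set (Sym2 V)) (e : Sym2 V) : Prop :=
  ∀ v ∈ e, contractMap D v ∈ contractTerminals R D

theorem contractMap_mem_mono {R : Finset V} {D D' : Set (Sym2 V)} (h : D ⊆ D') {v : V}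
    (hv : contractMap D v ∈ contractTerminals R D) :
    contractMap D' v ∈ contractTerminals R D' := by
  obtain ⟨r, hr, hrv⟩ := hv
  exact ⟨r, hr, contractMap_mono h hrv⟩

theorem JoinsTerminals.mono {R : Finset V} {D D' : Set (Sym2 V)} (h : D ⊆ D') {e : Sym2 V}
    (he : JoinsTerminals R D e) : JoinsTerminals R D' e :=
  fun v hv => contractMap_mem_mono h (he v hv)

/-- `E` connects all vertices in `K`. -/
def Connects (E : Set (Sym2 V)) (K : Finset V) : Prop :=
  ∀ u ∈ K, ∀ v ∈ K, contractMap E u = contractMap E v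

theorem exists_lift_contractMap {D E : Set (Sym2 V)} (h : D ⊆ E) :
    ∃ ψ : ContractVertex D → ContractVertex E, ∀ v, ψ (contractMap D v) = contractMap E v :=
  ⟨SimpleGraph.ConnectedComponent.map
    (SimpleGraph.Hom.ofLE (SimpleGraph.fromEdgeSet_mono h)), fun _ => rfl⟩

theorem connects_of_induce_connected {R : Finset V} {D T : Set (Sym2 V)}
    (h : ((SimpleGraph.fromEdgeSet (Sym2.map (contractMap D) '' T)).induce
      (contractTerminals R D)).Connected) : Connects (D ∪ T) R := by
  intro u hu v hv
  obtain ⟨ψ, hψ⟩ := exists_lift_contractMap (D := D) (E := D ∪ T) Set.subset_union_left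
  have := apply_eq_of_reachable (fun x : contractTerminals R D => ψ x) ?_
    (h.preconnected ⟨contractMap D u, u, hu, rfl⟩ ⟨contractMap D v, v, hv, rfl⟩)
  · simpa [hψ] using this
  · rintro ⟨x, hx⟩ ⟨y, hy⟩ hxy
    simp only [SimpleGraph.comap_adj, Function.Embedding.subtype_apply,
      SimpleGraph.fromEdgeSet_adj] at hxy
    obtain ⟨⟨e, he, hexy⟩, -⟩ := hxy
    induction e using Sym2.ind with | _ a b
    rw [Sym2.map_mk, Sym2.eq_iff] at hexy
    have hab : contractMap (D ∪ T) a = contractMap (D ∪ T) b :=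
      contractMap_eq_of_mem (Or.inr he)
    rcases hexy with ⟨rfl, rfl⟩ | ⟨rfl, rfl⟩ <;> simp [hψ, hab]

theorem induce_connected_of_connects {R : Finset V} (hR : R.Nonempty) {D T : Set (Sym2 V)}
    (hT : ∀ e ∈ T, JoinsTerminals R D e) (h : Connects (D ∪ T) R) :
    ((SimpleGraph.fromEdgeSet (Sym2.map (contractMap D) '' T)).induce
      (contractTerminals R D)).Connected := by
  classical
  set Q := (SimpleGraph.fromEdgeSet (Sym2.map (contractMap D) '' T)).induce
      (contractTerminals R D) with hQ
  obtain ⟨r, hr⟩ := hR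
  have : Nonempty (contractTerminals R D) := ⟨⟨contractMap D r, r, hr, rfl⟩⟩
  refine ⟨?_⟩
  rintro ⟨_, u, hu, rfl⟩ ⟨_, v, hv, rfl⟩
  -- Vertices outside the terminals of `G / D` get the label `none`. Edges in `D` do not change the
  -- label, and edges in `T` are loops or edges of `Q`.
  set f : V → Option Q.ConnectedComponent := fun x =>
    if hx : contractMap D x ∈ contractTerminals R D then
      some (Q.connectedComponentMk ⟨contractMap D x, hx⟩) else none with hf
  have hval : ∀ x (hx : contractMap D x ∈ contractTerminals R D),
      f x = some (Q.connectedComponentMk ⟨contractMap D x, hx⟩) := fun x hx => dif_pos hx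
  have huv : f u = f v := by
    refine apply_eq_of_contractMap_eq f (fun x y hxy => ?_) (h u hu v hv)
    by_cases hD : contractMap D x = contractMap D y
    · simp only [hf, hD]
    rcases hxy with hxy | hxy
    · exact absurd (contractMap_eq_of_mem hxy) hD
    · have hx := hT _ hxy x (Sym2.mem_mk_left x y)
      have hy := hT _ hxy y (Sym2.mem_mk_right x y)
      rw [hval x hx, hval y hy]
      refine congrArg some (SimpleGraph.ConnectedComponent.eq.2 (SimpleGraph.Adj.reachable ?_))
      simp only [hQ, SimpleGraph.comap_adj, Function.Embedding.subtype_apply,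
        SimpleGraph.fromEdgeSet_adj]
      exact ⟨⟨_, hxy, rfl⟩, hD⟩
  rw [hval u ⟨u, hu, rfl⟩, hval v ⟨v, hv, rfl⟩] at huv
  exact SimpleGraph.ConnectedComponent.eq.1 (Option.some.inj huv)

theorem image_edgeSet_induce {W : Type*} (S : Set (Sym2 W)) (s : Set W)
    (hS : ∀ e ∈ S, ∀ v ∈ e, v ∈ s) :
    Sym2.map ((↑) : s → W) '' ((SimpleGraph.fromEdgeSet S).induce s).edgeSet =
      S \ {e | e.IsDiag} := by
  ext e
  induction e using Sym2.ind with | _ a b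
  constructor
  · rintro ⟨e, he, heab⟩
    induction e using Sym2.ind with | _ x y
    rw [← heab]
    simpa [SimpleGraph.mem_edgeSet] using he
  · rintro ⟨hab, hne⟩
    refine ⟨s(⟨a, hS _ hab a (Sym2.mem_mk_left a b)⟩, ⟨b, hS _ hab b (Sym2.mem_mk_right a b)⟩),
      ?_, rfl⟩
    simpa [SimpleGraph.mem_edgeSet] using ⟨hab, by simpa using hne⟩

/-- Terminal spanning trees are the connecting sets of edges between terminals that have one edge
less than there are terminals. -/
theorem isTerminalSpanningTree_iff [Finite V] {G : SimpleGraph V} {R : Finset V} (hR : R.Nonempty)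
    {D T : Set (Sym2 V)} :
    IsTerminalSpanningTree G R D T ↔
      T ⊆ G.edgeSet ∧ (∀ e ∈ T, JoinsTerminals R D e) ∧ Connects (D ∪ T) R ∧
        T.ncard + 1 = classCount R D := by
  have key : (∀ e ∈ T, JoinsTerminals R D e) →
      Nat.card ((SimpleGraph.fromEdgeSet (Sym2.map (contractMap D) '' T)).induce
        (contractTerminals R D)).edgeSet =
      (Sym2.map (contractMap D) '' T \ {e | e.IsDiag}).ncard := by
    intro hT
    rw [← image_edgeSet_induce _ (contractTerminals R D),
      Set.ncard_image_of_injective _ (Sym2.map.injective Subtype.val_injective),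
      Nat.card_coe_set_eq]
    rintro _ ⟨e, he, rfl⟩ v hv
    obtain ⟨u, hu, rfl⟩ := Sym2.mem_map.1 hv
    exact hT e he u hu
  have hfin : Finite (contractTerminals R D) := (R.finite_toSet.image _).to_subtype
  constructor
  · rintro ⟨h1, h2, h3, h4, h5⟩
    refine ⟨h1, h2, connects_of_induce_connected h5.1, ?_⟩
    have h6 := (SimpleGraph.isTree_iff_connected_and_card.1 h5).2
    rw [key h2, Nat.card_coe_set_eq] at h6
    rw [classCount, ← h6, sdiff_eq_left.2, h4.ncard_image]
    rw [Set.disjoint_left]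
    rintro _ ⟨e, he, rfl⟩
    exact h3 e he
  · rintro ⟨h1, h2, h3, h4⟩
    have hc := induce_connected_of_connects hR h2 h3
    -- A connected graph on these terminals needs as many edges as `T` has, so passing to the image
    -- and discarding loops loses nothing: `T` has no loops and no parallel edges in `G / D`.
    have h5 := hc.card_vert_le_card_edgeSet_add_one
    rw [key h2, Nat.card_coe_set_eq] at h5
    change classCount R D ≤ _ at h5
    have h6 : (Sym2.map (contractMap D) '' T \ {e | e.IsDiag}).ncard ≤
        (Sym2.map (contractMap D) '' T).ncard :=
      Set.ncard_le_ncard Set.sdiff_subset (T.toFinite.image _)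
    have h7 : (Sym2.map (contractMap D) '' T).ncard ≤ T.ncard := Set.ncard_image_le T.toFinite
    have h8 : Sym2.map (contractMap D) '' T \ {e | e.IsDiag} = Sym2.map (contractMap D) '' T :=
      Set.eq_of_subset_of_ncard_le Set.sdiff_subset (by omega) (T.toFinite.image _)
    refine ⟨h1, h2, fun e he hd => ?_, (Set.ncard_image_iff T.toFinite).1 (by omega), ?_⟩
    · exact (h8.ge ⟨e, he, rfl⟩).2 hd
    · refine SimpleGraph.isTree_iff_connected_and_card.2 ⟨hc, ?_⟩
      rw [key h2, Nat.card_coe_set_eq]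
      change _ = classCount R D
      omega

/-- A connecting set of edges between terminals contains a terminal spanning tree. -/
theorem exists_isTerminalSpanningTree [Finite V] {G : SimpleGraph V} {R : Finset V}
    (hR : R.Nonempty) {D S : Set (Sym2 V)} (hSG : S ⊆ G.edgeSet)
    (hS : ∀ e ∈ S, JoinsTerminals R D e) (hc : Connects (D ∪ S) R) :
    ∃ T ⊆ S, IsTerminalSpanningTree G R D T := by
  -- The sets in which every edge lowers the number of classes by one are the forests in `G / D`. In
  -- a maximal one, every edge of `S` has its ends already connected, for otherwise it could be
  -- added.
  have hfin : {T : Set (Sym2 V) | T ⊆ S ∧ classCount R (D ∪ T) + T.ncard = classCount R D}.Finite :=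
    Set.toFinite _
  obtain ⟨T, ⟨hTS, hcard⟩, hmax⟩ := hfin.exists_maximal ⟨∅, by simp⟩
  have hconn : ∀ u v, s(u, v) ∈ S → contractMap (D ∪ T) u = contractMap (D ∪ T) v := by
    intro u v huv
    by_contra hne
    have hnT : s(u, v) ∉ T := fun h => hne (contractMap_eq_of_mem (Or.inr h))
    have hsub : insert s(u, v) T ⊆ S := Set.insert_subset huv hTS
    obtain ⟨a, ha, hau⟩ := hS _ huv u (Sym2.mem_mk_left u v)
    obtain ⟨b, hb, hbv⟩ := hS _ huv v (Sym2.mem_mk_right u v)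
    have hle : D ∪ T ⊆ D ∪ insert s(u, v) T :=
      Set.union_subset_union_right _ (Set.subset_insert _ _)
    have hau' : contractMap (D ∪ T) a = contractMap (D ∪ T) u :=
      contractMap_mono Set.subset_union_left hau
    have hbv' : contractMap (D ∪ T) b = contractMap (D ∪ T) v :=
      contractMap_mono Set.subset_union_left hbv
    have hab : contractMap (D ∪ insert s(u, v) T) a = contractMap (D ∪ insert s(u, v) T) b :=
      (contractMap_mono hle hau').trans
        ((contractMap_eq_of_mem (Or.inr (Set.mem_insert _ _))).trans
          (contractMap_mono hle hbv').symm)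
    classical
    have h1 := classCount_add_le (R := R) (K := {a, b}) (E := D ∪ T)
      (E' := D ∪ insert s(u, v) T) (by intro x; simp; rintro (rfl | rfl) <;> assumption)
      (by simp) (fun _ _ => contractMap_mono hle) (by
        intro x hx y hy
        simp only [Finset.mem_insert, Finset.mem_singleton] at hx hy
        rcases hx with rfl | rfl <;> rcases hy with rfl | rfl <;> simp [hab])
    have h2 : 2 ≤ classCount {a, b} (D ∪ T) :=
      two_le_classCount (u := a) (v := b) (by simp) (by simp) (by rwa [hau', hbv'])
    have h3 := classCount_le_union R D (insert s(u, v) T)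
    rw [Set.ncard_insert_of_notMem hnT] at h3
    have h4 := hmax (y := insert s(u, v) T)
      ⟨hsub, by rw [Set.ncard_insert_of_notMem hnT]; omega⟩ (Set.subset_insert _ _)
    exact hnT (h4 (Set.mem_insert _ _))
  have hc' : Connects (D ∪ T) R := by
    intro u hu v hv
    refine apply_eq_of_contractMap_eq _ (fun x y hxy => ?_) (hc u hu v hv)
    rcases hxy with hxy | hxy
    · exact contractMap_eq_of_mem (Or.inl hxy)
    · exact hconn x y hxy
  refine ⟨T, hTS, (isTerminalSpanningTree_iff hR).2
    ⟨hTS.trans hSG, fun e he => hS e (hTS he), hc', ?_⟩⟩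
  rw [← hcard, classCount_eq_one hR hc', add_comm]

/-- The number of classes of a part of a terminal spanning tree. -/
theorem IsTerminalSpanningTree.classCount_eq [Finite V] {G : SimpleGraph V} {R : Finset V}
    (hR : R.Nonempty) {D T : Set (Sym2 V)} (hT : IsTerminalSpanningTree G R D T)
    {S : Set (Sym2 V)} (hS : S ⊆ T) : classCount R (D ∪ S) = (T \ S).ncard + 1 := by
  obtain ⟨-, -, h3, h4⟩ := (isTerminalSpanningTree_iff hR).1 hT
  -- Each edge lowers the count by at most one, and `T` lowers it from `T.ncard + 1` to 1, so no
  -- edge of `S` or `T \ S` is wasted.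
  have h5 := classCount_le_union R D S
  have h6 := classCount_le_union R (D ∪ S) (T \ S)
  rw [Set.union_assoc, Set.union_sdiff_cancel hS, classCount_eq_one hR h3] at h6
  have h7 := Set.ncard_sdiff_add_ncard_of_subset hS T.toFinite
  omega

/-- The edges of cost at most `t`. -/
def cheap (c : Sym2 V → ℝ≥0) (T : Set (Sym2 V)) (t : ℝ) : Set (Sym2 V) :=
  {e ∈ T | (c e : ℝ) ≤ t}

theorem cheap_subset (c : Sym2 V → ℝ≥0) (T : Set (Sym2 V)) (t : ℝ) : cheap c T t ⊆ T :=
  fun _ h => h.1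

theorem cheap_mono (c : Sym2 V → ℝ≥0) (T : Set (Sym2 V)) : Monotone (cheap c T) :=
  fun _ _ h _ he => ⟨he.1, he.2.trans h⟩

theorem subset_edgeSet_fromEdgeSet {G : SimpleGraph V} {T : Set (Sym2 V)} (hT : T ⊆ G.edgeSet) :
    T ⊆ (SimpleGraph.fromEdgeSet T).edgeSet := by
  rw [SimpleGraph.edgeSet_fromEdgeSet]
  exact fun e he => ⟨he, fun hd => G.not_isDiag_of_mem_edgeSet (hT he) hd⟩

end SpanningTrees

/-! ### Edge costs and the exchange property of minimum trees -/

section Costs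

variable {V : Type*} [Fintype V]

theorem edgeCost_mono (c : Sym2 V → ℝ≥0) {E E' : Set (Sym2 V)} (h : E ⊆ E') :
    edgeCost c E ≤ edgeCost c E' :=
  Finset.sum_le_sum fun _ _ => Set.indicator_le_indicator_of_subset h (fun _ => zero_le) _

theorem edgeCost_mono_cost {c c' : Sym2 V → ℝ≥0} {E : Set (Sym2 V)} (h : ∀ e ∈ E, c e ≤ c' e) :
    edgeCost c E ≤ edgeCost c' E :=
  Finset.sum_le_sum fun e _ => by
    by_cases he : e ∈ E
    · simpa [he] using h e he
    · simp [he]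

theorem edgeCost_congr {c c' : Sym2 V → ℝ≥0} {E : Set (Sym2 V)} (h : ∀ e ∈ E, c e = c' e) :
    edgeCost c E = edgeCost c' E :=
  le_antisymm (edgeCost_mono_cost fun e he => (h e he).le)
    (edgeCost_mono_cost fun e he => (h e he).ge)

theorem edgeCost_union_le (c : Sym2 V → ℝ≥0) (E E' : Set (Sym2 V)) :
    edgeCost c (E ∪ E') ≤ edgeCost c E + edgeCost c E' := by
  rw [edgeCost, edgeCost, edgeCost, ← Finset.sum_add_distrib]
  refine Finset.sum_le_sum fun e _ => ?_
  by_cases he : e ∈ E <;> by_cases he' : e ∈ E' <;> simp [he, he']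

theorem edgeCost_singleton (c : Sym2 V → ℝ≥0) (e : Sym2 V) : edgeCost c {e} = c e := by
  classical
  simp [edgeCost, Set.indicator_apply]

@[simp] theorem edgeCost_empty (c : Sym2 V → ℝ≥0) : edgeCost c ∅ = 0 := by
  simp [edgeCost]

theorem edgeCost_insert (c : Sym2 V → ℝ≥0) {e : Sym2 V} {E : Set (Sym2 V)} (he : e ∉ E) :
    edgeCost c (insert e E) = c e + edgeCost c E := by
  rw [← edgeCost_singleton c e, edgeCost, edgeCost, edgeCost, ← Finset.sum_add_distrib]
  refine Finset.sum_congr rfl fun x _ => ?_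
  rw [Set.insert_eq, Set.indicator_union_of_disjoint (by simpa using he)]

theorem edgeCost_insert_le (c : Sym2 V → ℝ≥0) (e : Sym2 V) (E : Set (Sym2 V)) :
    edgeCost c (insert e E) ≤ c e + edgeCost c E := by
  rw [← edgeCost_singleton c e]
  exact edgeCost_union_le c {e} E

theorem edgeCost_diff_singleton (c : Sym2 V → ℝ≥0) {e : Sym2 V} {E : Set (Sym2 V)} (he : e ∈ E) :
    c e + edgeCost c (E \ {e}) = edgeCost c E := by
  rw [← edgeCost_insert c (by simp), Set.insert_sdiff_singleton, Set.insert_eq_of_mem he]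

/-- In a minimum terminal spanning tree, the ends of an edge between terminals are connected by
edges that are not more expensive. -/
theorem IsMinTerminalSpanningTree.contractMap_cheap_eq {G : SimpleGraph V} {c : Sym2 V → ℝ≥0}
    {R : Finset V} (hR : R.Nonempty) {D T : Set (Sym2 V)}
    (hT : IsMinTerminalSpanningTree G c R D T) {a b : V} (hG : s(a, b) ∈ G.edgeSet)
    (hab : JoinsTerminals R D s(a, b)) {t : ℝ} (ht : (c s(a, b) : ℝ) ≤ t) :
    contractMap (D ∪ cheap c T t) a = contractMap (D ∪ cheap c T t) b := by
  by_contra hne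
  obtain ⟨h1, h2, h3, h4⟩ := (isTerminalSpanningTree_iff hR).1 hT.1
  have hTab : contractMap (D ∪ T) a = contractMap (D ∪ T) b := by
    obtain ⟨x, hx, hxa⟩ := hab a (Sym2.mem_mk_left a b)
    obtain ⟨y, hy, hyb⟩ := hab b (Sym2.mem_mk_right a b)
    exact (contractMap_mono Set.subset_union_left hxa).symm.trans
      ((h3 x hx y hy).trans (contractMap_mono Set.subset_union_left hyb))
  -- Exchange argument: let `S` be maximal among the parts of `T` that contain the cheap edges and
  -- do not connect `a` and `b`. Any `g` in `T` outside `S` costs more than `t` and would connect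
  -- them, so replacing `g` by `s(a, b)` gives a cheaper tree.
  have hfin : {S : Set (Sym2 V) | cheap c T t ⊆ S ∧ S ⊆ T ∧
      contractMap (D ∪ S) a ≠ contractMap (D ∪ S) b}.Finite := Set.toFinite _
  obtain ⟨S, ⟨hS1, hS2, hS3⟩, hmax⟩ :=
    hfin.exists_maximal ⟨cheap c T t, subset_rfl, cheap_subset c T t, hne⟩
  have heT : s(a, b) ∉ T := fun h => hne (contractMap_eq_of_mem (Or.inr ⟨h, ht⟩))
  obtain ⟨g, hgT, hgS⟩ : ∃ g ∈ T, g ∉ S := by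
    by_contra hcon
    push Not at hcon
    exact hS3 (by rwa [hS2.antisymm hcon])
  have hg : contractMap (D ∪ insert g S) a = contractMap (D ∪ insert g S) b := by
    by_contra hcon
    exact hgS (hmax (y := insert g S) ⟨hS1.trans (Set.subset_insert _ _),
      Set.insert_subset hgT hS2, hcon⟩ (Set.subset_insert _ _) (Set.mem_insert _ _))
  have hgcost : t < c g := by
    by_contra hcon
    exact hgS (hS1 ⟨hgT, not_lt.1 hcon⟩)
  have hgends : ∀ u v, g = s(u, v) →
      contractMap (D ∪ insert s(a, b) S) u = contractMap (D ∪ insert s(a, b) S) v := by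
    rintro u v rfl
    set m := contractMap (D ∪ S) with hm
    have hle : D ∪ S ⊆ D ∪ insert s(a, b) S :=
      Set.union_subset_union_right _ (Set.subset_insert _ _)
    have hedge : contractMap (D ∪ insert s(a, b) S) a = contractMap (D ∪ insert s(a, b) S) b :=
      contractMap_eq_of_mem (Or.inr (Set.mem_insert _ _))
    classical
    -- Merging the class of `v` into that of `u` must identify `a` and `b`. As these are in
    -- different classes of `D ∪ S`, one is in the class of `u` and the other in that of `v`.
    have hf : (if m a = m v then m u else m a) = if m b = m v then m u else m b := by
      refine apply_eq_of_contractMap_eq (fun x => if m x = m v then m u else m x)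
        (fun x y hxy => ?_) hg
      by_cases hxy' : m x = m y
      · simp only [hxy']
      rcases hxy with hxy | hxy | hxy
      · exact absurd (contractMap_eq_of_mem (Or.inl hxy)) hxy'
      · rw [Sym2.eq_iff] at hxy
        rcases hxy with ⟨rfl, rfl⟩ | ⟨rfl, rfl⟩ <;> simp
      · exact absurd (contractMap_eq_of_mem (Or.inr hxy)) hxy'
    split_ifs at hf with hav hbv hbv
    · exact absurd (hav.trans hbv.symm) hS3
    · exact (contractMap_mono hle hf).trans (hedge.symm.trans (contractMap_mono hle hav))
    · exact (contractMap_mono hle hf).symm.trans (hedge.trans (contractMap_mono hle hbv))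
    · exact absurd hf hS3
  have hnew : IsTerminalSpanningTree G R D (insert s(a, b) (T \ {g})) := by
    refine (isTerminalSpanningTree_iff hR).2
      ⟨Set.insert_subset hG (Set.sdiff_subset.trans h1), ?_, ?_, ?_⟩
    · rintro e (rfl | he)
      · exact hab
      · exact h2 e he.1
    · intro x hx y hy
      refine apply_eq_of_contractMap_eq _ (fun u v huv => ?_) (h3 x hx y hy)
      rcases huv with huv | huv
      · exact contractMap_eq_of_mem (Or.inl huv)
      · by_cases huvg : g = s(u, v)
        · refine contractMap_mono (Set.union_subset_union_right _
            (Set.insert_subset_insert ?_)) (hgends u v huvg)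
          exact fun e he => ⟨hS2 he, fun h => hgS (h ▸ he)⟩
        · exact contractMap_eq_of_mem (Or.inr (Or.inr ⟨huv, fun h => huvg h.symm⟩))
    · rw [Set.ncard_insert_of_notMem fun h => heT h.1, Set.ncard_sdiff_singleton_add_one hgT
        T.toFinite]
      exact h4
  have h5 := hT.2 _ hnew
  rw [edgeCost_insert c fun h => heT h.1, ← edgeCost_diff_singleton c hgT,
    add_le_add_iff_right] at h5
  have h6 : (c g : ℝ) ≤ c s(a, b) := by exact_mod_cast h5
  linarith

end Costs

/-! ### Rank integrals over cost thresholds -/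

section Thresholds

variable {V : Type*}

theorem intervalIntegrable_rank (c : Sym2 V → ℝ≥0) (K : Finset V) (D T : Set (Sym2 V)) (a b : ℝ) :
    IntervalIntegrable (fun t => (classCount K (D ∪ cheap c T t) : ℝ) - 1)
      MeasureTheory.volume a b := by
  refine Antitone.intervalIntegrable fun s t hst => ?_
  have := classCount_anti K (Set.union_subset_union_right D (cheap_mono c T hst))
  have : (classCount K (D ∪ cheap c T t) : ℝ) ≤ classCount K (D ∪ cheap c T s) := by
    exact_mod_cast this
  simpa using this

variable [Fintype V]

/-- All edge costs are at most this number. -/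
noncomputable def maxCost (c : Sym2 V → ℝ≥0) : ℝ := edgeCost c Set.univ

theorem maxCost_nonneg (c : Sym2 V → ℝ≥0) : 0 ≤ maxCost c := NNReal.coe_nonneg _

theorem cost_le_maxCost (c : Sym2 V → ℝ≥0) (e : Sym2 V) : (c e : ℝ) ≤ maxCost c := by
  rw [maxCost, NNReal.coe_le_coe, ← edgeCost_singleton c e]
  exact edgeCost_mono c (Set.subset_univ _)

/-- The integral, over all thresholds `t`, of the rank contribution of `K` for the partition into
the classes of `D` and the edges in `T` of cost at most `t`. -/
noncomputable def rankIntegral (c : Sym2 V → ℝ≥0) (K : Finset V) (D T : Set (Sym2 V)) : ℝ :=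
  ∫ t in (0 : ℝ)..maxCost c, ((classCount K (D ∪ cheap c T t) : ℝ) - 1)

theorem rankIntegral_mono (c : Sym2 V → ℝ≥0) (K : Finset V) {D T D' T' : Set (Sym2 V)}
    (h : ∀ t, classCount K (D ∪ cheap c T t) ≤ classCount K (D' ∪ cheap c T' t)) :
    rankIntegral c K D T ≤ rankIntegral c K D' T' := by
  refine intervalIntegral.integral_mono_on (maxCost_nonneg c) (intervalIntegrable_rank _ _ _ _ _ _)
    (intervalIntegrable_rank _ _ _ _ _ _) fun t _ => ?_
  have : (classCount K (D ∪ cheap c T t) : ℝ) ≤ classCount K (D' ∪ cheap c T' t) := by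
    exact_mod_cast h t
  linarith

/-- The layer-cake formula for a single edge of cost `a`. The strict inequality matches the edges
missing from `cheap`. -/
theorem integral_lt_indicator {a M : ℝ} (ha : 0 ≤ a) (haM : a ≤ M) :
    ∫ t in (0 : ℝ)..M, (if t < a then (1 : ℝ) else 0) = a := by
  have hanti : Antitone fun t : ℝ => if t < a then (1 : ℝ) else 0 := by
    intro s t hst
    dsimp only
    split_ifs <;> linarith
  have h1 : ∫ t in (0 : ℝ)..a, (if t < a then (1 : ℝ) else 0) = ∫ _ in (0 : ℝ)..a, (1 : ℝ) := by
    refine intervalIntegral.integral_congr_ae ?_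
    have : ∀ᵐ t : ℝ, t ≠ a := by
      simp [MeasureTheory.ae_iff]
    filter_upwards [this] with t hta ht
    rw [Set.uIoc_of_le ha] at ht
    exact if_pos (lt_of_le_of_ne ht.2 hta)
  have h2 : ∫ t in a..M, (if t < a then (1 : ℝ) else 0) = ∫ _ in a..M, (0 : ℝ) := by
    refine intervalIntegral.integral_congr fun t ht => ?_
    rw [Set.uIcc_of_le haM] at ht
    exact if_neg (not_lt.2 ht.1)
  rw [← intervalIntegral.integral_add_adjacent_intervals (b := a) hanti.intervalIntegrable
    hanti.intervalIntegrable, h1, h2]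
  simp

/-- The cost of a set of edges as an integral over all thresholds. -/
theorem integral_ncard_diff_cheap (c : Sym2 V → ℝ≥0) (T : Set (Sym2 V)) :
    ∫ t in (0 : ℝ)..maxCost c, ((T \ cheap c T t).ncard : ℝ) = edgeCost c T := by
  classical
  have h : ∀ t : ℝ, ((T \ cheap c T t).ncard : ℝ) =
      ∑ e : Sym2 V, if e ∈ T then (if t < c e then (1 : ℝ) else 0) else 0 := by
    intro t
    have : T \ cheap c T t = ((Finset.univ.filter fun e => e ∈ T ∧ t < c e : Finset (Sym2 V)) :
        Set (Sym2 V)) := by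
      ext e
      simp only [cheap, Set.mem_sdiff, Set.mem_ofPred_eq, Finset.coe_filter, Finset.mem_univ,
        true_and, not_and, not_le]
      tauto
    rw [this, Set.ncard_coe_finset, Finset.card_filter]
    push_cast
    refine Finset.sum_congr rfl fun e _ => ?_
    split_ifs <;> simp_all
  have hint : ∀ e : Sym2 V, IntervalIntegrable
      (fun t : ℝ => if e ∈ T then (if t < c e then (1 : ℝ) else 0) else 0)
      MeasureTheory.volume 0 (maxCost c) := by
    intro e
    refine Antitone.intervalIntegrable fun s t hst => ?_
    split_ifs <;> linarith
  simp_rw [h]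
  rw [intervalIntegral.integral_finsetSum fun e _ => hint e, edgeCost, NNReal.coe_sum]
  refine Finset.sum_congr rfl fun e _ => ?_
  by_cases he : e ∈ T
  · simpa [he] using integral_lt_indicator (c e).coe_nonneg (cost_le_maxCost c e)
  · simp [he]

/-- The classes at threshold `t` exceed by one the tree edges costing more than `t`, so the
layer-cake formula applies. -/
theorem IsTerminalSpanningTree.rankIntegral_eq {G : SimpleGraph V} {R : Finset V}
    (hR : R.Nonempty) {D T : Set (Sym2 V)} (hT : IsTerminalSpanningTree G R D T)
    (c : Sym2 V → ℝ≥0) : rankIntegral c R D T = edgeCost c T := by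
  rw [← integral_ncard_diff_cheap]
  unfold rankIntegral
  congr 1
  ext t
  rw [hT.classCount_eq hR (cheap_subset c T t)]
  push_cast
  ring

theorem exists_isMinTerminalSpanningTree {G : SimpleGraph V} {R : Finset V} {D S : Set (Sym2 V)}
    (hS : IsTerminalSpanningTree G R D S) (c : Sym2 V → ℝ≥0) :
    ∃ T, IsMinTerminalSpanningTree G c R D T := by
  obtain ⟨T, hT, hmin⟩ :=
    (Set.toFinite {T | IsTerminalSpanningTree G R D T}).exists_minimalFor (edgeCost c) _ ⟨S, hS⟩
  exact ⟨T, hT, fun T' hT' => (le_total _ _).elim id fun h => hmin hT' h⟩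

theorem mtst_le {G : SimpleGraph V} {R : Finset V} {D S : Set (Sym2 V)}
    (hS : IsTerminalSpanningTree G R D S) (c : Sym2 V → ℝ≥0) : mtst G c R D ≤ edgeCost c S :=
  csInf_le (OrderBot.bddBelow _) ⟨S, hS, rfl⟩

theorem IsMinTerminalSpanningTree.mtst_eq {G : SimpleGraph V} {R : Finset V} {D T : Set (Sym2 V)}
    {c : Sym2 V → ℝ≥0} (hT : IsMinTerminalSpanningTree G c R D T) :
    mtst G c R D = edgeCost c T :=
  (mtst_le hT.1 c).antisymm
    (le_csInf ⟨_, T, hT.1, rfl⟩ (by rintro _ ⟨T', hT', rfl⟩; exact hT.2 T' hT'))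

/-- The drop of a set of edges that connects `K`, for the tree `T` in `G / D`, is at least the
integral of the rank contributions of `K`. -/
theorem rankIntegral_le_drop {G : SimpleGraph V} {c : Sym2 V → ℝ≥0} {R K : Finset V}
    {D T E : Set (Sym2 V)} (hT : IsTerminalSpanningTree G R D T)
    (hKR : K ⊆ R) (hK : K.Nonempty) (hE : Connects E K) :
    rankIntegral c K D T ≤ drop G c R D T E := by
  have hR : R.Nonempty := hK.mono hKR
  obtain ⟨h1, h2, h3, h4⟩ := (isTerminalSpanningTree_iff hR).1 hT
  have hTG := subset_edgeSet_fromEdgeSet h1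
  have hW : ∀ e ∈ T, JoinsTerminals R (D ∪ E) e := fun e he =>
    (h2 e he).mono Set.subset_union_left
  obtain ⟨S, -, hS⟩ := exists_isTerminalSpanningTree (D := D ∪ E) hR hTG hW fun u hu v hv =>
    contractMap_mono (Set.union_subset_union_left _ Set.subset_union_left) (h3 u hu v hv)
  obtain ⟨T', hT'⟩ := exists_isMinTerminalSpanningTree hS c
  obtain ⟨g1, g2, g3, g4⟩ := (isTerminalSpanningTree_iff hR).1 hT'.1
  have hT'T : T' ⊆ T := fun e he => by
    have := g1 he
    rw [SimpleGraph.edgeSet_fromEdgeSet] at this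
    exact this.1
  have hT'G : IsTerminalSpanningTree G R (D ∪ E) T' :=
    (isTerminalSpanningTree_iff hR).2 ⟨hT'T.trans h1, g2, g3, g4⟩
  -- At every threshold, `D ∪ E` with the cheap part of `T'` connects all that `D` and the cheap
  -- part of `T` connect, and the whole of `K` as well. Integrating compares the costs of `T` and
  -- `T'`.
  have hpoint : ∀ t, classCount R (D ∪ E ∪ cheap c T' t) + classCount K (D ∪ cheap c T t) ≤
      classCount R (D ∪ cheap c T t) + 1 := by
    intro t
    refine classCount_add_le hKR hK (fun u v huv => ?_) fun u hu v hv =>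
      contractMap_mono (Set.subset_union_right.trans Set.subset_union_left) (hE u hu v hv)
    refine apply_eq_of_contractMap_eq _ (fun x y hxy => ?_) huv
    rcases hxy with hxy | hxy
    · exact contractMap_eq_of_mem (Or.inl (Or.inl hxy))
    · exact hT'.contractMap_cheap_eq hR (hTG hxy.1) (hW _ hxy.1) hxy.2
  have hint : rankIntegral c R (D ∪ E) T' + rankIntegral c K D T ≤ rankIntegral c R D T := by
    unfold rankIntegral
    rw [← intervalIntegral.integral_add (intervalIntegrable_rank _ _ _ _ _ _)
      (intervalIntegrable_rank _ _ _ _ _ _)]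
    refine intervalIntegral.integral_mono_on (maxCost_nonneg c)
      ((intervalIntegrable_rank _ _ _ _ _ _).add (intervalIntegrable_rank _ _ _ _ _ _))
      (intervalIntegrable_rank _ _ _ _ _ _) fun t _ => ?_
    have : (classCount R (D ∪ E ∪ cheap c T' t) : ℝ) + classCount K (D ∪ cheap c T t) ≤
      classCount R (D ∪ cheap c T t) + 1 := by exact_mod_cast hpoint t
    linarith
  rw [hT'G.rankIntegral_eq hR, hT.rankIntegral_eq hR] at hint
  have : (mtst G c R (D ∪ E) : ℝ) ≤ edgeCost c T' := by exact_mod_cast mtst_le hT'G c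
  unfold drop
  linarith

/-- Rank integrals do not grow when further edges are contracted. -/
theorem rankIntegral_anti {G : SimpleGraph V} {c : Sym2 V → ℝ≥0} {R : Finset V}
    (hR : R.Nonempty) (K : Finset V) {D T D' T' : Set (Sym2 V)} (hD : D ⊆ D')
    (hT : IsTerminalSpanningTree G R D T) (hT' : IsMinTerminalSpanningTree G c R D' T') :
    rankIntegral c K D' T' ≤ rankIntegral c K D T := by
  refine rankIntegral_mono c K fun t => classCount_le_of_factors K fun u _ v _ huv => ?_
  -- A cheap edge of `T` still joins terminals of `G / D'`, so minimality of `T'` connects its ends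
  -- at the same threshold.
  refine apply_eq_of_contractMap_eq _ (fun x y hxy => ?_) huv
  obtain ⟨h1, h2, -⟩ := (isTerminalSpanningTree_iff hR).1 hT
  rcases hxy with hxy | hxy
  · exact contractMap_eq_of_mem (Or.inl (hD hxy))
  · exact hT'.contractMap_cheap_eq hR (h1 hxy.1) ((h2 _ hxy.1).mono hD) hxy.2

/-- Applied to components that have been contracted: they meet a single class at every threshold, so
they satisfy their dual constraint trivially. -/
theorem rankIntegral_nonpos_of_connects {c : Sym2 V → ℝ≥0} {K : Finset V} (hK : K.Nonempty)
    {D T : Set (Sym2 V)} (h : Connects D K) : rankIntegral c K D T ≤ 0 := by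
  have : ∀ t, classCount K (D ∪ cheap c T t) = 1 := fun t =>
    classCount_eq_one hK fun u hu v hv => contractMap_mono Set.subset_union_left (h u hu v hv)
  simp [rankIntegral, this]

end Thresholds

/-! ### Spanning trees as dual solutions of the partition LP -/

section PartitionLP

variable {V : Type*} [DecidableEq V]

open Classical in
/-- The partition of `R` into the classes of the edge set `E`. -/
noncomputable def classPartition (R : Finset V) (E : Set (Sym2 V)) : Finpartition R :=
  Finpartition.ofSetSetoid (Setoid.ker (contractMap E)) R

/-- Two terminals in `K` have the same part exactly when they have the same class, so both maps on
`K` have equally many values. -/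
theorem card_filter_classPartition {R K : Finset V} (hKR : K ⊆ R) (E : Set (Sym2 V)) :
    ((classPartition R E).parts.filter fun P => (K ∩ P).Nonempty).card = classCount K E := by
  classical
  have hinj : ∀ a ∈ K, ∀ b ∈ K, R.filter (fun x => contractMap E a = contractMap E x) =
      R.filter (fun x => contractMap E b = contractMap E x) →
        contractMap E a = contractMap E b := by
    intro a ha b hb hab
    have : b ∈ R.filter (fun x => contractMap E b = contractMap E x) := by simp [hKR hb]
    rw [← hab] at this
    exact (Finset.mem_filter.1 this).2
  have h1 : (classPartition R E).parts.filter (fun P => (K ∩ P).Nonempty) =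
      K.image fun a => R.filter fun x => contractMap E a = contractMap E x := by
    ext P
    simp only [classPartition, Finpartition.ofSetSetoid, Finset.mem_filter, Finset.mem_image]
    constructor
    · rintro ⟨⟨a, ha, rfl⟩, b, hb⟩
      obtain ⟨hbK, hbP⟩ := Finset.mem_inter.1 hb
      obtain ⟨hbR, hab⟩ := Finset.mem_filter.1 hbP
      refine ⟨b, hbK, ?_⟩
      ext x
      have hab : contractMap E a = contractMap E b := hab
      simp [Setoid.ker_def, hab]
    · rintro ⟨a, ha, rfl⟩
      exact ⟨⟨a, hKR ha, by ext x; simp [Setoid.ker_def]⟩, a, by simp [ha, hKR ha]⟩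
  rw [h1, ← Set.ncard_coe_finset, Finset.coe_image, classCount, contractTerminals]
  refine le_antisymm (ncard_image_le_of_factors K.finite_toSet _ _ fun a ha b hb hab => ?_)
    (ncard_image_le_of_factors K.finite_toSet _ _ hinj)
  simp [hab]

theorem card_classPartition {R : Finset V} (E : Set (Sym2 V)) :
    (classPartition R E).parts.card = classCount R E := by
  rw [← card_filter_classPartition subset_rfl, Finset.filter_true_of_mem]
  intro P hP
  rw [Finset.inter_eq_right.2 ((classPartition R E).le hP)]
  exact (classPartition R E).nonempty_of_mem_parts hP

/-- Lower bound on the partition LP: the dual solution given by a spanning tree. -/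
theorem edgeCost_le_partitionOpt [Fintype V] {G : SimpleGraph V} {c w : Sym2 V → ℝ≥0} {R : Finset V}
    (hR : R.Nonempty) {G' : SimpleGraph V} {D T : Set (Sym2 V)}
    (hT : IsTerminalSpanningTree G' R D T) {a : ℝ} (ha : 0 ≤ a)
    (h : ∀ K H, IsFullComponent G R K H → a * rankIntegral w K D T ≤ edgeCost c H.edgeSet) :
    ENNReal.ofReal (a * edgeCost w T) ≤ partitionOpt G c R := by
  refine le_iInf₂ fun x hx => ?_
  -- Positive weight on a hyperedge of infinite cost makes the objective infinite. Otherwise such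
  -- hyperedges have weight 0 and contribute 0 to both sides.
  by_cases htop : ∃ K ∈ hyperedges R, hyperedgeCost G c R K = ⊤ ∧ x K ≠ 0
  · obtain ⟨K, hK, hKtop, hxK⟩ := htop
    have : hyperedgeCost G c R K * (x K : ℝ≥0∞) = ⊤ := by
      rw [hKtop, ENNReal.top_mul (by exact_mod_cast hxK)]
    calc _ ≤ ⊤ := le_top
      _ = _ := this.symm
      _ ≤ _ := Finset.single_le_sum (f := fun K => hyperedgeCost G c R K * (x K : ℝ≥0∞))
        (fun _ _ => zero_le) hK
  push Not at htop
  have hK : ∀ K ∈ hyperedges R, ENNReal.ofReal (a * (x K * rankIntegral w K D T)) ≤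
      hyperedgeCost G c R K * (x K : ℝ≥0∞) := by
    intro K hK
    by_cases hKt : hyperedgeCost G c R K = ⊤
    · simp [htop K hK hKt]
    rw [mul_left_comm, mul_comm, ENNReal.ofReal_mul' (x K).coe_nonneg, ENNReal.ofReal_coe_nnreal]
    refine mul_le_mul_left (le_iInf₂ fun H hH => ?_) _
    rw [← ENNReal.ofReal_coe_nnreal]
    exact ENNReal.ofReal_le_ofReal (h K H hH)
  -- The LP constraint for the partition at threshold `t`, integrated over `t`. Its left side
  -- integrates to the cost of `T`.
  have hsum : (edgeCost w T : ℝ) ≤ ∑ K ∈ hyperedges R, x K * rankIntegral w K D T := by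
    rw [← hT.rankIntegral_eq hR]
    unfold rankIntegral
    simp_rw [← intervalIntegral.integral_const_mul]
    rw [← intervalIntegral.integral_finsetSum fun K _ =>
      (intervalIntegrable_rank w K D T 0 (maxCost w)).const_mul _]
    refine intervalIntegral.integral_mono_on (maxCost_nonneg w)
      (intervalIntegrable_rank _ _ _ _ _ _) ?_ fun t _ => ?_
    · have := IntervalIntegrable.sum (hyperedges R) fun K _ =>
        (intervalIntegrable_rank w K D T 0 (maxCost w)).const_mul (x K : ℝ)
      simpa only [Finset.sum_fn] using this
    have := hx (classPartition R (D ∪ cheap w T t))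
    rw [card_classPartition] at this
    refine this.trans (Finset.sum_le_sum fun K hK => ?_)
    rw [rankContribution, card_filter_classPartition]
    exact Finset.mem_powerset.1 (Finset.mem_filter.1 hK).1
  calc ENNReal.ofReal (a * edgeCost w T)
      ≤ ENNReal.ofReal (∑ K ∈ hyperedges R, a * (x K * rankIntegral w K D T)) := by
        rw [← Finset.mul_sum]
        exact ENNReal.ofReal_le_ofReal (mul_le_mul_of_nonneg_left hsum ha)
    -- Subadditivity makes the signs of the summands irrelevant.
    _ ≤ ∑ K ∈ hyperedges R, ENNReal.ofReal (a * (x K * rankIntegral w K D T)) :=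
        Finset.le_sum_of_subadditive _ ENNReal.ofReal_zero.le (fun _ _ => ENNReal.ofReal_add_le) _ _
    _ ≤ _ := Finset.sum_le_sum hK

end PartitionLP

/-! ### Full components -/

section FullComponents

variable {V : Type*} {G : SimpleGraph V} {R K : Finset V} {H : G.Subgraph}

theorem contractMap_edgeSet_eq (hH : H.coe.Connected) {u v : V} (hu : u ∈ H.verts)
    (hv : v ∈ H.verts) : contractMap H.edgeSet u = contractMap H.edgeSet v :=
  apply_eq_of_reachable (fun x : H.verts => contractMap H.edgeSet x)
    (fun _ _ hxy => contractMap_eq_of_mem (H.mem_edgeSet.2 hxy))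
    (hH.preconnected ⟨u, hu⟩ ⟨v, hv⟩)

theorem IsFullComponent.mem_iff (h : IsFullComponent G R K H) (v : V) :
    v ∈ K ↔ v ∈ H.verts ∧ v ∈ R := by
  rw [← Finset.mem_coe, ← h.2.1]
  rfl

theorem IsFullComponent.subset (h : IsFullComponent G R K H) : K ⊆ R :=
  fun v hv => ((h.mem_iff v).1 hv).2

theorem IsFullComponent.connects (h : IsFullComponent G R K H) : Connects H.edgeSet K :=
  fun u hu v hv =>
    contractMap_edgeSet_eq h.1.1 ((h.mem_iff u).1 hu).1 ((h.mem_iff v).1 hv).1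

/-- A tree has a vertex with at most one neighbour, and in a full component such a vertex is a
terminal. -/
theorem IsFullComponent.nonempty [Finite V] (h : IsFullComponent G R K H) : K.Nonempty := by
  classical
  have := Fintype.ofFinite V
  have : Fintype H.verts := Fintype.ofFinite _
  suffices ∃ v ∈ H.verts, (H.neighborSet v).Subsingleton by
    obtain ⟨v, hv, hs⟩ := this
    exact ⟨v, (h.mem_iff v).2 ⟨hv, (h.2.2 v hv).2 hs⟩⟩
  rcases subsingleton_or_nontrivial H.verts with hsub | hnon
  · obtain ⟨v, hv⟩ := h.1.1.nonempty
    refine ⟨v, hv, fun a ha b hb => ?_⟩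
    exact congrArg Subtype.val (hsub.elim ⟨a, H.edge_vert (SimpleGraph.Subgraph.Adj.symm ha)⟩
      ⟨b, H.edge_vert (SimpleGraph.Subgraph.Adj.symm hb)⟩)
  · obtain ⟨⟨v, hv⟩, hdeg⟩ := h.1.exists_vert_degree_one_of_nontrivial
    refine ⟨v, hv, fun a ha b hb => ?_⟩
    obtain ⟨w, -, hw⟩ := SimpleGraph.degree_eq_one_iff_existsUnique_adj.1
      (show H.coe.degree ⟨v, hv⟩ = 1 by convert hdeg)
    exact congrArg Subtype.val ((hw ⟨a, H.edge_vert (SimpleGraph.Subgraph.Adj.symm ha)⟩ ha).trans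
      (hw ⟨b, H.edge_vert (SimpleGraph.Subgraph.Adj.symm hb)⟩ hb).symm)

/-- A full component with an edge between two terminals has no other edge. -/
theorem IsFullComponent.edgeSet_eq_singleton (h : IsFullComponent G R K H) {u v : V}
    (hu : u ∈ R) (hv : v ∈ R) (huv : H.Adj u v) : H.edgeSet = {s(u, v)} := by
  have hnu := (h.2.2 u (H.edge_vert huv)).1 hu
  have hnv := (h.2.2 v (H.edge_vert huv.symm)).1 hv
  -- Both `u` and `v` are leaves, so no edge leaves the pair and connectedness excludes further
  -- vertices.
  have hverts : ∀ x ∈ H.verts, x = u ∨ x = v := by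
    intro x hx
    have := apply_eq_of_reachable (fun y : H.verts => (y : V) = u ∨ (y : V) = v) ?_
      (h.1.1.preconnected ⟨u, H.edge_vert huv⟩ ⟨x, hx⟩)
    · exact this.mp (Or.inl rfl)
    · rintro ⟨a, ha⟩ ⟨b, hb⟩ hab
      have hab : H.Adj a b := hab
      refine propext ⟨?_, ?_⟩
      · rintro (rfl | rfl)
        · exact Or.inr (hnu hab huv)
        · exact Or.inl (hnv hab huv.symm)
      · rintro (rfl | rfl)
        · exact Or.inr (hnu hab.symm huv)
        · exact Or.inl (hnv hab.symm huv.symm)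
  ext e
  induction e using Sym2.ind with | _ a b
  rw [SimpleGraph.Subgraph.mem_edgeSet, Set.mem_singleton_iff, Sym2.eq_iff]
  constructor
  · intro hab
    have := hab.ne
    rcases hverts a (H.edge_vert hab) with rfl | rfl <;>
      rcases hverts b (H.edge_vert hab.symm) with rfl | rfl <;> simp_all
  · rintro (⟨rfl, rfl⟩ | ⟨rfl, rfl⟩)
    exacts [huv, huv.symm]

/-- Contraction merges the Steiner vertices of the component with one of its terminals. -/
theorem IsFullComponent.joinsTerminals [Finite V] (h : IsFullComponent G R K H)
    {D : Set (Sym2 V)} (hD : H.edgeSet ⊆ D) {e : Sym2 V} (he : e ∈ H.edgeSet) :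
    JoinsTerminals R D e := by
  obtain ⟨r, hr⟩ := h.nonempty
  intro v hv
  exact ⟨r, h.subset hr, contractMap_mono hD (contractMap_edgeSet_eq h.1.1
    ((h.mem_iff r).1 hr).1 (H.mem_verts_of_mem_edge he hv))⟩

end FullComponents

/-! ### Doubling and shortcutting: the factor 2 for the initial tree -/

section Tours

variable {V : Type*}

/-- The cost of a walk, given by the list of its vertices. -/
def walkCost (c : Sym2 V → ℝ≥0) : List V → ℝ≥0
  | a :: b :: l => c s(a, b) + walkCost c (b :: l)
  | _ => 0

/-- The set of edges of a walk, given by the list of its vertices. -/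
def walkEdges : List V → Set (Sym2 V)
  | a :: b :: l => insert s(a, b) (walkEdges (b :: l))
  | _ => ∅

theorem edgeCost_walkEdges_le [Fintype V] (c : Sym2 V → ℝ≥0) (l : List V) :
    edgeCost c (walkEdges l) ≤ walkCost c l := by
  induction l with
  | nil => simp [walkEdges]
  | cons a l ih =>
    cases l with
    | nil => simp [walkEdges]
    | cons b l => exact (edgeCost_insert_le _ _ _).trans (by rw [walkCost]; gcongr)

theorem mem_of_mem_walkEdges {l : List V} {e : Sym2 V} (he : e ∈ walkEdges l) {v : V}
    (hv : v ∈ e) : v ∈ l := by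
  induction l with
  | nil => exact absurd he (Set.notMem_empty _)
  | cons a l ih =>
    cases l with
    | nil => exact absurd he (Set.notMem_empty _)
    | cons b l =>
      rcases he with rfl | he
      · rcases Sym2.mem_iff.1 hv with rfl | rfl <;> simp
      · exact List.mem_cons_of_mem _ (ih he)

theorem contractMap_walkEdges_eq {l : List V} {u v : V} (hu : u ∈ l) (hv : v ∈ l) :
    contractMap (walkEdges l) u = contractMap (walkEdges l) v := by
  induction l generalizing u v with
  | nil => simp at hu
  | cons a l ih =>
    cases l with
    | nil => simp_all
    | cons b l =>
      have h : ∀ x ∈ a :: b :: l, contractMap (walkEdges (a :: b :: l)) x =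
          contractMap (walkEdges (a :: b :: l)) b := by
        intro x hx
        rcases List.mem_cons.1 hx with rfl | hx
        · exact contractMap_eq_of_mem (Set.mem_insert _ _)
        · exact contractMap_mono (Set.subset_insert _ _) (ih hx (by simp))
      exact (h u hu).trans (h v hv).symm

theorem walkCost_append_detour (c : Sym2 V → ℝ≥0) (l₁ l₂ : List V) (x y : V) :
    walkCost c (l₁ ++ x :: y :: x :: l₂) = walkCost c (l₁ ++ x :: l₂) + 2 * c s(x, y) := by
  induction l₁ with
  | nil =>
    simp only [List.nil_append, walkCost, Sym2.eq_swap (a := y) (b := x)]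
    ring
  | cons a l₁ ih =>
    cases l₁ with
    | nil =>
      simp only [List.nil_append, List.cons_append, walkCost] at ih ⊢
      rw [ih, add_assoc]
    | cons b l₁ =>
      simp only [List.cons_append, walkCost] at ih ⊢
      rw [ih, add_assoc]

/-- Skipping a vertex replaces two edges by one, or drops a final edge. The fixed head `a` keeps the
left end of the shortcut available to the induction. -/
theorem walkCost_cons_le_of_sublist {c : Sym2 V → ℝ≥0}
    (hc : ∀ u v w, c s(u, w) ≤ c s(u, v) + c s(v, w)) {l l' : List V} (h : l'.Sublist l) (a : V) :
    walkCost c (a :: l') ≤ walkCost c (a :: l) := by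
  induction h generalizing a with
  | slnil => rfl
  | @cons l₁ l₂ b _ ih =>
    refine (ih a).trans ?_
    cases l₂ with
    | nil => simp [walkCost]
    | cons d l₂ =>
      simp only [walkCost, ← add_assoc]
      gcongr
      exact hc _ _ _
  | cons_cons b _ ih =>
    simp only [walkCost]
    gcongr
    exact ih b

theorem walkCost_le_of_sublist {c : Sym2 V → ℝ≥0}
    (hc : ∀ u v w, c s(u, w) ≤ c s(u, v) + c s(v, w)) {l l' : List V} (h : l'.Sublist l) :
    walkCost c l' ≤ walkCost c l := by
  induction h with
  | slnil => rfl
  | @cons l₁ l₂ b _ ih =>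
    refine ih.trans ?_
    cases l₂ with
    | nil => simp [walkCost]
    | cons d l₂ => simp [walkCost]
  | cons_cons b h _ => exact walkCost_cons_le_of_sublist hc h b

/-- A connected graph can be toured at twice the cost of its edges. -/
theorem exists_tour [Fintype V] (c : Sym2 V → ℝ≥0) {G : SimpleGraph V} {H : G.Subgraph}
    (hH : H.coe.Connected) :
    ∃ l : List V, (∀ v ∈ H.verts, v ∈ l) ∧ walkCost c l ≤ 2 * edgeCost c H.edgeSet := by
  -- Tours are grown vertex by vertex: an edge from `x` in `X` to a new `y` is inserted as the
  -- detour `x, y, x`, at twice its cost. Keeping the ends of `E` inside `X` ensures that this edge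
  -- is not yet in `E`.
  have hfin : {X : Set V | X ⊆ H.verts ∧ X.Nonempty ∧ ∃ l : List V, {v | v ∈ l} = X ∧
      ∃ E ⊆ H.edgeSet, (∀ e ∈ E, ∀ v ∈ e, v ∈ X) ∧ walkCost c l ≤ 2 * edgeCost c E}.Finite :=
    Set.toFinite _
  obtain ⟨r, hr⟩ := hH.nonempty
  obtain ⟨X, ⟨hXH, ⟨x₀, hx₀⟩, l, hl, E, hEH, hEX, hcost⟩, hmax⟩ := hfin.exists_maximal
    ⟨{r}, by simpa using hr, by simp, [r], by ext; simp, ∅, by simp, by simp, by simp [walkCost]⟩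
  have hX : ∀ v ∈ H.verts, v ∈ X := by
    intro v hv
    by_contra hvX
    have hcross : ∃ x y, H.Adj x y ∧ x ∈ X ∧ y ∉ X := by
      by_contra hcon
      push Not at hcon
      have := apply_eq_of_reachable (fun z : H.verts => (z : V) ∈ X)
        (fun a b hab => propext ⟨fun ha => hcon _ _ hab ha, fun hb =>
          hcon _ _ (SimpleGraph.Subgraph.Adj.symm hab) hb⟩)
        (hH.preconnected ⟨x₀, hXH hx₀⟩ ⟨v, hv⟩)
      exact hvX (this.mp hx₀)
    obtain ⟨x, y, hxy, hx, hy⟩ := hcross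
    have hxl : x ∈ l := hl.ge hx
    obtain ⟨l₁, l₂, rfl⟩ := List.append_of_mem hxl
    have hyE : s(x, y) ∉ E := fun h => hy (hEX _ h y (Sym2.mem_mk_right x y))
    refine hy (hmax (y := insert y X) ⟨?_, ⟨y, Set.mem_insert _ _⟩, l₁ ++ x :: y :: x :: l₂, ?_,
      insert s(x, y) E, ?_, ?_, ?_⟩ (Set.subset_insert _ _) (Set.mem_insert _ _))
    · exact Set.insert_subset (H.edge_vert hxy.symm) hXH
    · rw [← hl]
      ext z
      simp only [List.mem_append, List.mem_cons, Set.mem_ofPred_eq, Set.mem_insert_iff]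
      tauto
    · exact Set.insert_subset hxy hEH
    · rintro e (rfl | he) v hv
      · rcases Sym2.mem_iff.1 hv with rfl | rfl
        exacts [Or.inr hx, Or.inl rfl]
      · exact Or.inr (hEX e he v hv)
    · rw [walkCost_append_detour, edgeCost_insert c hyE, mul_add, add_comm]
      gcongr
  refine ⟨l, fun v hv => hl.ge (hX v hv), hcost.trans ?_⟩
  gcongr
  exact edgeCost_mono c hEH

/-- Since `S` connects `K`, its edges costing more than `t` number at least the classes of its cheap
part meeting `K`, minus one. Integrating gives the cost of `S`. -/
theorem rankIntegral_le_edgeCost [Fintype V] {c : Sym2 V → ℝ≥0} {K : Finset V}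
    (hK : K.Nonempty) {D T S : Set (Sym2 V)} (hS : Connects S K)
    (h : ∀ t, classCount K (D ∪ cheap c T t) ≤ classCount K (cheap c S t)) :
    rankIntegral c K D T ≤ edgeCost c S := by
  rw [← integral_ncard_diff_cheap]
  refine intervalIntegral.integral_mono_on (maxCost_nonneg c) (intervalIntegrable_rank _ _ _ _ _ _)
    (Antitone.intervalIntegrable fun s t hst => ?_) fun t _ => ?_
  · exact_mod_cast Set.ncard_le_ncard (Set.sdiff_subset_sdiff_right (cheap_mono c S hst))
      (Set.toFinite _)
  · have h1 := classCount_le_union K (cheap c S t) (S \ cheap c S t)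
    rw [Set.union_sdiff_cancel (cheap_subset c S t), classCount_eq_one hK hS] at h1
    have h2 := (h t).trans h1
    have : (classCount K (D ∪ cheap c T t) : ℝ) ≤ 1 + (S \ cheap c S t).ncard := by
      exact_mod_cast h2
    linarith

/-- For metric costs, the rank integral of a full component for a minimum terminal spanning tree is
at most twice its cost. -/
theorem rankIntegral_le_two_mul [Fintype V] {c : Sym2 V → ℝ≥0}
    (hc : ∀ u v w, c s(u, w) ≤ c s(u, v) + c s(v, w)) {R K : Finset V} {T : Set (Sym2 V)}
    (hT : IsMinTerminalSpanningTree ⊤ c R ∅ T) {G : SimpleGraph V} {H : G.Subgraph}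
    (hH : IsFullComponent G R K H) :
    rankIntegral c K ∅ T ≤ 2 * edgeCost c H.edgeSet := by
  classical
  obtain ⟨l, hl, hcost⟩ := exists_tour c hH.1.1
  have hKl : ∀ v, v ∈ l.filter (fun v => v ∈ K) ↔ v ∈ K := by
    intro v
    simp only [List.mem_filter, decide_eq_true_eq, and_iff_right_iff_imp]
    exact fun hv => hl v ((hH.mem_iff v).1 hv).1
  have h1 : rankIntegral c K ∅ T ≤ edgeCost c (walkEdges (l.filter fun v => v ∈ K)) := by
    refine rankIntegral_le_edgeCost hH.nonempty
      (fun u hu v hv => contractMap_walkEdges_eq ((hKl u).2 hu) ((hKl v).2 hv)) fun t => ?_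
    refine classCount_le_of_factors K fun u _ v _ huv => ?_
    refine apply_eq_of_contractMap_eq _ (fun x y hxy => ?_) huv
    -- Deleting Steiner vertices from the tour can make a terminal its own successor; such loops are
    -- not edges of `⊤`.
    by_cases hne : x = y
    · rw [hne]
    have hK : ∀ z ∈ s(x, y), z ∈ R := fun z hz =>
      hH.subset ((hKl z).1 (mem_of_mem_walkEdges hxy.1 hz))
    exact hT.contractMap_cheap_eq (hH.nonempty.mono hH.subset) (by simpa using hne)
      (fun z hz => ⟨z, hK z hz, rfl⟩) hxy.2
  have h2 : edgeCost c (walkEdges (l.filter fun v => v ∈ K)) ≤ 2 * edgeCost c H.edgeSet :=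
    (edgeCost_walkEdges_le c _).trans
      ((walkCost_le_of_sublist hc List.filter_sublist).trans hcost)
  exact h1.trans (by exact_mod_cast h2)

end Tours

/-! ### Invariants of the heuristic and its guarantee -/

section Heuristic

variable {V : Type*}

theorem joinsTerminals_empty {R : Finset V} {e : Sym2 V} :
    JoinsTerminals R ∅ e ↔ ∀ v ∈ e, v ∈ R := by
  constructor
  · intro h v hv
    obtain ⟨r, hr, hrv⟩ := h v hv
    have : r = v := apply_eq_of_contractMap_eq id (fun _ _ h => absurd h (Set.notMem_empty _)) hrv
    rwa [← this]
  · exact fun h v hv => ⟨v, h v hv, rfl⟩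

variable [Fintype V]

theorem edgeCost_const_mul (a : ℝ≥0) (c : Sym2 V → ℝ≥0) (E : Set (Sym2 V)) :
    edgeCost (fun e => a * c e) E = a * edgeCost c E := by
  classical
  simp [edgeCost, Finset.mul_sum, Set.indicator_apply]

/-- Terminal spanning trees exist after further contractions. -/
theorem IsTerminalSpanningTree.exists_isMin_of_subset {G : SimpleGraph V} {R : Finset V}
    (hR : R.Nonempty) {D D' T : Set (Sym2 V)} (hT : IsTerminalSpanningTree G R D T) (hD : D ⊆ D')
    (c : Sym2 V → ℝ≥0) : ∃ T', IsMinTerminalSpanningTree G c R D' T' := by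
  obtain ⟨h1, h2, h3, -⟩ := (isTerminalSpanningTree_iff hR).1 hT
  obtain ⟨S, -, hS⟩ := exists_isTerminalSpanningTree (D := D') hR h1 (fun e he => (h2 e he).mono hD)
    fun u hu v hv => contractMap_mono (Set.union_subset_union_left _ hD) (h3 u hu v hv)
  exact exists_isMinTerminalSpanningTree hS c

theorem exists_isMinTerminalSpanningTree_top {R : Finset V} (hR : R.Nonempty)
    (c : Sym2 V → ℝ≥0) : ∃ T, IsMinTerminalSpanningTree ⊤ c R ∅ T := by
  have hconn : Connects (∅ ∪ {e | e ∈ (⊤ : SimpleGraph V).edgeSet ∧ ∀ v ∈ e, v ∈ R}) R := by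
    intro u hu v hv
    by_cases huv : u = v
    · rw [huv]
    · refine contractMap_eq_of_mem (Or.inr ⟨by simpa using huv, fun w hw => ?_⟩)
      rcases Sym2.mem_iff.1 hw with rfl | rfl <;> assumption
  obtain ⟨S, -, hS⟩ := exists_isTerminalSpanningTree hR (fun e he => he.1)
    (fun e he => joinsTerminals_empty.2 he.2) hconn
  exact exists_isMinTerminalSpanningTree hS c

/-- Edges between terminals have no positive gain. -/
theorem gain_singleton_nonpos {G : SimpleGraph V} {c : Sym2 V → ℝ≥0} {R : Finset V}
    {D T : Set (Sym2 V)} (hT : IsMinTerminalSpanningTree G c R D T) {u v : V} (hu : u ∈ R)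
    (hv : v ∈ R) (huv : s(u, v) ∈ G.edgeSet) : gain G c R D T {s(u, v)} ≤ 0 := by
  have hR : R.Nonempty := ⟨u, hu⟩
  obtain ⟨S, hS⟩ := hT.1.exists_isMin_of_subset hR
    (Set.subset_union_left (s := D) (t := {s(u, v)})) c
  obtain ⟨h1, h2, h3, -⟩ := (isTerminalSpanningTree_iff hR).1 hS.1
  -- Contracting an edge between two terminals turns no further vertex into a terminal, so a tree
  -- `S` after the contraction, plus the edge, is a connecting set of edges between terminals of `G
  -- / D`.
  have hjoin : ∀ x r, contractMap (D ∪ {s(u, v)}) r = contractMap (D ∪ {s(u, v)}) x → r ∈ R →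
      contractMap D x ∈ contractTerminals R D := by
    intro x r hrx hr
    refine (apply_eq_of_contractMap_eq (fun x => contractMap D x ∈ contractTerminals R D)
      (fun a b hab => ?_) hrx).mp ⟨r, hr, rfl⟩
    rcases hab with hab | hab
    · simp only [contractMap_eq_of_mem hab]
    · have hu' : contractMap D u ∈ contractTerminals R D := ⟨u, hu, rfl⟩
      have hv' : contractMap D v ∈ contractTerminals R D := ⟨v, hv, rfl⟩
      rcases Sym2.eq_iff.1 hab with ⟨rfl, rfl⟩ | ⟨rfl, rfl⟩ <;> simp [hu', hv']
  obtain ⟨T', hT'S, hT'⟩ := exists_isTerminalSpanningTree (G := G) (R := R) (D := D)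
    (S := insert s(u, v) S) hR (Set.insert_subset huv h1) (by
      rintro e (rfl | he) x hx
      · rcases Sym2.mem_iff.1 hx with rfl | rfl
        exacts [⟨_, hu, rfl⟩, ⟨_, hv, rfl⟩]
      · obtain ⟨r, hr, hrx⟩ := h2 e he x hx
        exact hjoin x r hrx hr)
    (fun a ha b hb => contractMap_mono (by
      rw [Set.union_assoc, Set.singleton_union]) (h3 a ha b hb))
  have h4 : edgeCost c T ≤ c s(u, v) + edgeCost c S :=
    (hT.2 T' hT').trans ((edgeCost_mono c hT'S).trans (edgeCost_insert_le c _ _))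
  have h5 : (edgeCost c T : ℝ) ≤ c s(u, v) + edgeCost c S := by exact_mod_cast h4
  rw [gain, drop, hS.mtst_eq, edgeCost_singleton]
  linarith

theorem exists_scan {G : SimpleGraph V} {c : Sym2 V → ℝ≥0} {R : Finset V} (hR : R.Nonempty)
    (F : Finset V → G.Subgraph) (L : List (Finset V)) {D T : Set (Sym2 V)}
    (hT : IsTerminalSpanningTree G R D T) : ∃ D' T', Scan G c R F D T L D' T' := by
  induction L generalizing D T with
  | nil => exact ⟨D, T, .done D T⟩
  | cons K L ih =>
    rcases le_or_gt (gain G c R D T (F K).edgeSet) 0 with hgain | hgain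
    · obtain ⟨D', T', h⟩ := ih hT
      exact ⟨D', T', .skip hgain h⟩
    · obtain ⟨T₁, hT₁⟩ := hT.exists_isMin_of_subset hR
        (Set.subset_union_left (s := D) (t := (F K).edgeSet)) c
      obtain ⟨D', T', h⟩ := ih hT₁.1
      exact ⟨D', T', .contract hgain hT₁ h⟩

variable [DecidableEq V]

theorem reducedCost_le (c : Sym2 V → ℝ≥0) (R : Finset V) (e : Sym2 V) :
    reducedCost c R e ≤ c e := by
  unfold reducedCost
  split_ifs
  · refine div_le_self zero_le ?_
    rw [← NNReal.coe_le_coe, Real.coe_sqrt]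
    simp
  · rfl

theorem le_sqrt_two_mul_reducedCost (c : Sym2 V → ℝ≥0) (R : Finset V) (e : Sym2 V) :
    c e ≤ NNReal.sqrt 2 * reducedCost c R e := by
  unfold reducedCost
  split_ifs
  · rw [mul_div_cancel₀]
    simp
  · refine le_mul_of_one_le_left zero_le ?_
    rw [← NNReal.coe_le_coe, Real.coe_sqrt]
    simp

theorem reducedCost_of_subset (c : Sym2 V → ℝ≥0) {R : Finset V} {e : Sym2 V}
    (he : ∀ v ∈ e, v ∈ R) : c e = NNReal.sqrt 2 * reducedCost c R e := by
  rw [reducedCost, if_pos he, mul_div_cancel₀]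
  simp

/-- Before any contraction all tree edges join original terminals, so the reduction is a uniform
scaling. Later trees may use edges at merged Steiner vertices, and only an inequality remains. -/
theorem IsTerminalSpanningTree.edgeCost_eq {G : SimpleGraph V} {R : Finset V} {T : Set (Sym2 V)}
    (hT : IsTerminalSpanningTree G R ∅ T) (c : Sym2 V → ℝ≥0) :
    edgeCost c T = NNReal.sqrt 2 * edgeCost (reducedCost c R) T := by
  rw [← edgeCost_const_mul]
  exact edgeCost_congr fun e he => reducedCost_of_subset c (joinsTerminals_empty.1 (hT.2.1 e he))

theorem IsMinTerminalSpanningTree.of_reducedCost {G : SimpleGraph V} {R : Finset V}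
    {c : Sym2 V → ℝ≥0} {T : Set (Sym2 V)}
    (hT : IsMinTerminalSpanningTree G (reducedCost c R) R ∅ T) :
    IsMinTerminalSpanningTree G c R ∅ T := by
  refine ⟨hT.1, fun T' hT' => ?_⟩
  rw [hT.1.edgeCost_eq, hT'.edgeCost_eq]
  gcongr
  exact hT.2 T' hT'

/-- A full component of positive gain has no edge between terminals. -/
theorem IsFullComponent.edgeCost_reducedCost {G : SimpleGraph V} {c : Sym2 V → ℝ≥0}
    {R K : Finset V} {H : G.Subgraph} (hH : IsFullComponent G R K H) {D T : Set (Sym2 V)}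
    (hT : IsMinTerminalSpanningTree G (reducedCost c R) R D T)
    (hgain : 0 < gain G (reducedCost c R) R D T H.edgeSet) :
    edgeCost (reducedCost c R) H.edgeSet = edgeCost c H.edgeSet := by
  refine edgeCost_congr fun e he => if_neg fun hR => ?_
  induction e using Sym2.ind with | _ u v
  have hu := hR u (Sym2.mem_mk_left u v)
  have hv := hR v (Sym2.mem_mk_right u v)
  -- An edge between terminals would be the entire component, which then has no positive gain.
  rw [hH.edgeSet_eq_singleton hu hv he] at hgain
  exact hgain.not_ge (gain_singleton_nonpos hT hu hv (H.edgeSet_subset he))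

/-- The state of the heuristic after one pass: no examined full component has a positive gain, and
the contracted full components have been paid for by the reduction of the spanning tree. -/
theorem Scan.spec {G : SimpleGraph V} {c : Sym2 V → ℝ≥0} {R : Finset V} (hR : R.Nonempty)
    {F : Finset V → G.Subgraph} {L : List (Finset V)} {D T D' T' : Set (Sym2 V)}
    (h : Scan G (reducedCost c R) R F D T L D' T')
    (hF : ∀ K ∈ L, IsFullComponent G R K (F K))
    (hT : IsMinTerminalSpanningTree G (reducedCost c R) R D T) :
    IsMinTerminalSpanningTree G (reducedCost c R) R D' T' ∧ D ⊆ D' ∧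
      (∀ K ∈ L, rankIntegral (reducedCost c R) K D' T' ≤
        edgeCost (reducedCost c R) (F K).edgeSet) ∧
      edgeCost c D' + edgeCost (reducedCost c R) T' ≤
        edgeCost c D + edgeCost (reducedCost c R) T ∧
      ((∀ e ∈ D, JoinsTerminals R D e) → ∀ e ∈ D', JoinsTerminals R D' e) ∧
      (D ⊆ G.edgeSet → D' ⊆ G.edgeSet) := by
  induction h with
  | done D T => exact ⟨hT, subset_rfl, by simp, le_rfl, id, id⟩
  | @skip D T D' T' K L hgain hrest ih =>
    obtain ⟨h1, h2, h3, h4, h5, h6⟩ := ih (fun K hK => hF K (List.mem_cons_of_mem _ hK)) hT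
    refine ⟨h1, h2, ?_, h4, h5, h6⟩
    intro K' hK'
    rcases List.mem_cons.1 hK' with rfl | hK'
    · have hK := hF K' (by simp)
      -- When `K'` is rejected its drop is at most its cost. The rank integral is below the drop at
      -- that moment and does not grow afterwards.
      have h7 := rankIntegral_le_drop (c := reducedCost c R) hT.1 hK.subset hK.nonempty hK.connects
      have h8 := rankIntegral_anti hR K' h2 hT.1 h1
      unfold gain at hgain
      linarith
    · exact h3 K' hK'
  | @contract D T T₁ D' T' K L hgain htree hrest ih =>
    obtain ⟨h1, h2, h3, h4, h5, h6⟩ := ih (fun K hK => hF K (List.mem_cons_of_mem _ hK)) htree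
    have hK := hF K (by simp)
    refine ⟨h1, Set.subset_union_left.trans h2, ?_, ?_, fun hD => h5 ?_,
      fun hD => h6 (Set.union_subset hD (F K).edgeSet_subset)⟩
    · intro K' hK'
      rcases List.mem_cons.1 hK' with rfl | hK'
      · refine (rankIntegral_nonpos_of_connects hK.nonempty fun u hu v hv => ?_).trans
          (NNReal.coe_nonneg _)
        exact contractMap_mono (Set.subset_union_right.trans h2) (hK.connects u hu v hv)
      · exact h3 K' hK'
    · refine h4.trans ?_
      -- Positive gain means that the tree shrinks by more than the reduced cost of the component,
      -- which is also its true cost.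
      have h7 : edgeCost (reducedCost c R) T₁ + edgeCost c (F K).edgeSet ≤
          edgeCost (reducedCost c R) T := by
        have h8 := hK.edgeCost_reducedCost hT hgain
        rw [gain, drop, htree.mtst_eq, h8] at hgain
        rw [← NNReal.coe_le_coe]
        push_cast
        linarith
      calc edgeCost c (D ∪ (F K).edgeSet) + edgeCost (reducedCost c R) T₁
          ≤ edgeCost c D + edgeCost c (F K).edgeSet + edgeCost (reducedCost c R) T₁ := by
            gcongr
            exact edgeCost_union_le _ _ _
        _ = edgeCost c D + (edgeCost (reducedCost c R) T₁ + edgeCost c (F K).edgeSet) := by ring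
        _ ≤ _ := by gcongr
    · rintro e (he | he)
      · exact (hD e he).mono Set.subset_union_left
      · exact hK.joinsTerminals Set.subset_union_right he

/-- The output of the heuristic is connected and costs at most `2√2 - 1` times the optimal value of
the partition LP. -/
theorem IsHeuristicOutput.spec {c : Sym2 V → ℝ≥0} {R : Finset V} (hR : R.Nonempty)
    (hc : ∀ u v w, c s(u, w) ≤ c s(u, v) + c s(v, w))
    {F : Finset V → (⊤ : SimpleGraph V).Subgraph} {L : List (Finset V)}
    (hF : ∀ K, (∃ H, IsFullComponent ⊤ R K H) → IsMinFullComponent ⊤ c R K (F K))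
    (hL : ∀ K, K ∈ L ↔ ∃ H, IsFullComponent ⊤ R K H) {A : Set (Sym2 V)}
    (hA : IsHeuristicOutput ⊤ c R F L A) :
    A ⊆ (⊤ : SimpleGraph V).edgeSet ∧ Connects A R ∧ (∀ e ∈ A, JoinsTerminals R A e) ∧
      (edgeCost c A : ℝ≥0∞) ≤ ENNReal.ofReal (2 * √2 - 1) * partitionOpt ⊤ c R := by
  obtain ⟨T₁, D, T, hT₁, hscan, rfl⟩ := hA
  obtain ⟨h1, -, h3, h4, h5, h6⟩ :=
    hscan.spec hR (fun K hK => (hF K ((hL K).1 hK)).1) hT₁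
  obtain ⟨g1, g2, g3, -⟩ := (isTerminalSpanningTree_iff hR).1 h1.1
  refine ⟨Set.union_subset g1 (h6 (Set.empty_subset _)), by rwa [Set.union_comm], ?_, ?_⟩
  · rintro e (he | he)
    · exact (g2 e he).mono Set.subset_union_right
    · exact (h5 (by simp) e he).mono Set.subset_union_right
  have hone : (1 : ℝ) < √2 := by
    rw [Real.lt_sqrt] <;> norm_num
  have hbound₁ : ENNReal.ofReal (1 * edgeCost (reducedCost c R) T) ≤ partitionOpt ⊤ c R := by
    refine edgeCost_le_partitionOpt hR h1.1 zero_le_one fun K H hH => ?_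
    rw [one_mul]
    refine (h3 K ((hL K).2 ⟨H, hH⟩)).trans (NNReal.coe_le_coe.2 ?_)
    exact (edgeCost_mono_cost fun e _ => reducedCost_le c R e).trans ((hF K ⟨H, hH⟩).2 H hH)
  -- The initial tree is minimum for `c` too, so the touring bound applies with dual scaling `1 /
  -- 2`.
  have hbound₂ : ENNReal.ofReal (1 / 2 * edgeCost c T₁) ≤ partitionOpt ⊤ c R := by
    refine edgeCost_le_partitionOpt hR hT₁.1 (by norm_num) fun K H hH => ?_
    have := rankIntegral_le_two_mul hc hT₁.of_reducedCost hH
    linarith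
  -- With an infinite optimum the bound is trivial because the factor is positive; otherwise
  -- everything is moved to the reals.
  rcases eq_or_ne (partitionOpt ⊤ c R) ⊤ with htop | htop
  · rw [htop, ENNReal.mul_top]
    · exact le_top
    · simp only [ne_eq, ENNReal.ofReal_eq_zero, not_le]
      linarith
  rw [← ENNReal.ofReal_coe_nnreal, ← ENNReal.ofReal_toReal htop,
    ← ENNReal.ofReal_mul (by linarith)]
  refine ENNReal.ofReal_le_ofReal ?_
  rw [ENNReal.ofReal_le_iff_le_toReal htop] at hbound₁ hbound₂
  set p := (partitionOpt ⊤ c R).toReal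
  have e1 : (edgeCost c (T ∪ D) : ℝ) ≤ edgeCost c T + edgeCost c D := by
    exact_mod_cast edgeCost_union_le c T D
  have e2 : (edgeCost c T : ℝ) ≤ √2 * edgeCost (reducedCost c R) T := by
    have := edgeCost_mono_cost (E := T) fun e _ => le_sqrt_two_mul_reducedCost c R e
    rw [edgeCost_const_mul] at this
    have := NNReal.coe_le_coe.2 this
    push_cast [Real.coe_sqrt] at this
    exact this
  have e3 : (edgeCost c T₁ : ℝ) = √2 * edgeCost (reducedCost c R) T₁ := by
    have := congrArg NNReal.toReal (hT₁.1.edgeCost_eq c)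
    push_cast [Real.coe_sqrt] at this
    exact this
  have e4 : (edgeCost c D : ℝ) + edgeCost (reducedCost c R) T ≤ edgeCost (reducedCost c R) T₁ := by
    have := NNReal.coe_le_coe.2 h4
    push_cast [edgeCost_empty] at this
    linarith
  have e5 : √2 * √2 = 2 := Real.mul_self_sqrt (by norm_num)
  -- From c(T₁) ≤ 2p and c(T₁) = √2 c'(T₁), dividing by √2.
  have e6 : (edgeCost (reducedCost c R) T₁ : ℝ) ≤ √2 * p := by
    have : √2 * (√2 * (edgeCost (reducedCost c R) T₁ : ℝ)) ≤ √2 * (2 * p) := by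
      rw [← e3]
      exact mul_le_mul_of_nonneg_left (by linarith) (by linarith)
    rw [← mul_assoc, e5] at this
    linarith
  have e7 : (√2 - 1) * (edgeCost (reducedCost c R) T : ℝ) ≤ (√2 - 1) * p :=
    mul_le_mul_of_nonneg_left (by linarith) (by linarith)
  linarith

theorem exists_isHeuristicOutput {c : Sym2 V → ℝ≥0} {R : Finset V} (hR : R.Nonempty)
    (F : Finset V → (⊤ : SimpleGraph V).Subgraph) (L : List (Finset V)) :
    ∃ A, IsHeuristicOutput ⊤ c R F L A := by
  obtain ⟨T₁, hT₁⟩ := exists_isMinTerminalSpanningTree_top hR (reducedCost c R)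
  obtain ⟨D, T, h⟩ := exists_scan (c := reducedCost c R) hR F L hT₁.1
  exact ⟨T ∪ D, T₁, D, T, hT₁, h, rfl⟩

end Heuristic

/-! ### From edge sets to subgraphs and Steiner trees -/

section Subgraphs

variable {V : Type*}

/-- The component of the vertex `r` in the subgraph of `G` with edge set `E`. -/
def componentSubgraph (G : SimpleGraph V) (E : Set (Sym2 V)) (r : V) : G.Subgraph where
  verts := {v | contractMap E v = contractMap E r}
  Adj u v := G.Adj u v ∧ s(u, v) ∈ E ∧ contractMap E u = contractMap E r
  adj_sub h := h.1
  edge_vert h := h.2.2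
  symm := ⟨fun _ _ h => ⟨h.1.symm, Sym2.eq_swap ▸ h.2.1,
    (contractMap_eq_of_mem h.2.1).symm.trans h.2.2⟩⟩

theorem componentSubgraph_connected {G : SimpleGraph V} {E : Set (Sym2 V)} (hE : E ⊆ G.edgeSet)
    (r : V) : (componentSubgraph G E r).Connected := by
  classical
  set H := componentSubgraph G E r with hH
  have : Nonempty H.verts := ⟨⟨r, rfl⟩⟩
  refine ⟨⟨?_⟩⟩
  rintro ⟨u, hu⟩ ⟨v, hv⟩
  set f : V → Option H.coe.ConnectedComponent := fun x =>
    if hx : x ∈ H.verts then some (H.coe.connectedComponentMk ⟨x, hx⟩) else none with hf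
  have hval : ∀ x (hx : x ∈ H.verts), f x = some (H.coe.connectedComponentMk ⟨x, hx⟩) :=
    fun x hx => dif_pos hx
  have huv : f u = f v := by
    refine apply_eq_of_contractMap_eq f (fun x y hxy => ?_)
      (show contractMap E u = contractMap E v from Eq.trans hu (Eq.symm hv))
    by_cases hx : x ∈ H.verts
    · have hadj : H.Adj x y := ⟨hE hxy, hxy, hx⟩
      rw [hval x hx, hval y (H.edge_vert hadj.symm)]
      exact congrArg some (SimpleGraph.ConnectedComponent.eq.2 (SimpleGraph.Adj.reachable hadj))
    · have hy : y ∉ H.verts := fun hy => hx ((contractMap_eq_of_mem hxy).trans hy)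
      simp only [hf, dif_neg hx, dif_neg hy]
  rw [hval u hu, hval v hv] at huv
  exact SimpleGraph.ConnectedComponent.eq.1 (Option.some.inj huv)

theorem edgeSet_componentSubgraph_subset (G : SimpleGraph V) (E : Set (Sym2 V)) (r : V) :
    (componentSubgraph G E r).edgeSet ⊆ E := by
  intro e he
  induction e using Sym2.ind with | _ u v
  exact he.2.1

theorem edgeSet_componentSubgraph {G : SimpleGraph V} {E : Set (Sym2 V)} (hE : E ⊆ G.edgeSet)
    {r : V} (h : ∀ e ∈ E, ∀ v ∈ e, contractMap E v = contractMap E r) :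
    (componentSubgraph G E r).edgeSet = E := by
  refine (edgeSet_componentSubgraph_subset G E r).antisymm fun e he => ?_
  induction e using Sym2.ind with | _ u v
  exact ⟨hE he, he, h _ he u (Sym2.mem_mk_left u v)⟩

/-- A set of edges that connects all terminals contains a Steiner tree. -/
theorem exists_isSteinerTree {G : SimpleGraph V} {R : Finset V} (hR : R.Nonempty)
    {E : Set (Sym2 V)} (hE : E ⊆ G.edgeSet) (hc : Connects E R) :
    ∃ S : G.Subgraph, IsSteinerTree G R S ∧ S.edgeSet ⊆ E := by
  obtain ⟨r, hr⟩ := hR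
  set H := componentSubgraph G E r with hH
  obtain ⟨T, hTH, hT⟩ := (componentSubgraph_connected hE r).coe.exists_isTree_le
  let S : G.Subgraph :=
    { verts := H.verts
      Adj := fun u v => ∃ (hu : u ∈ H.verts) (hv : v ∈ H.verts), T.Adj ⟨u, hu⟩ ⟨v, hv⟩
      adj_sub := fun ⟨_, _, h⟩ => H.adj_sub (hTH h)
      edge_vert := fun ⟨hu, _, _⟩ => hu
      symm := ⟨fun _ _ ⟨hu, hv, h⟩ => ⟨hv, hu, h.symm⟩⟩ }
  have hS : S.coe = T := by
    ext ⟨u, hu⟩ ⟨v, hv⟩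
    exact ⟨fun ⟨_, _, h⟩ => h, fun h => ⟨hu, hv, h⟩⟩
  refine ⟨S, ⟨by rw [hS]; exact hT, fun v hv => hc v hv r hr⟩, fun e he => ?_⟩
  refine edgeSet_componentSubgraph_subset G E r ?_
  induction e using Sym2.ind with | _ u v
  obtain ⟨_, _, h⟩ := he
  exact hTH h

theorem IsFullComponent.map_top {G : SimpleGraph V} {R K : Finset V} {H : G.Subgraph}
    (h : IsFullComponent G R K H) :
    ∃ H' : (⊤ : SimpleGraph V).Subgraph, IsFullComponent ⊤ R K H' ∧ H'.edgeSet = H.edgeSet :=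
  ⟨{ verts := H.verts
     Adj := H.Adj
     adj_sub := fun h => (H.adj_sub h).ne
     edge_vert := H.edge_vert
     symm := H.symm }, h, rfl⟩

end Subgraphs

/-! ### Reduction of general graphs to the metric closure -/

section MetricClosure

variable {V : Type*} [Fintype V]

/-- The cost of a cheapest set of edges of `G` that connects the ends of `e`, that is, the length of
a shortest path between them. -/
noncomputable def metricCost (G : SimpleGraph V) (c : Sym2 V → ℝ≥0) (e : Sym2 V) : ℝ≥0 :=
  sInf (edgeCost c '' {B | B ⊆ G.edgeSet ∧ ∀ u ∈ e, ∀ v ∈ e, contractMap B u = contractMap B v})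

theorem metricCost_le {G : SimpleGraph V} (c : Sym2 V → ℝ≥0) {u v : V} {B : Set (Sym2 V)}
    (hB : B ⊆ G.edgeSet) (h : contractMap B u = contractMap B v) :
    metricCost G c s(u, v) ≤ edgeCost c B := by
  refine csInf_le (OrderBot.bddBelow _) ⟨B, ⟨hB, fun x hx y hy => ?_⟩, rfl⟩
  rcases Sym2.mem_iff.1 hx with rfl | rfl <;> rcases Sym2.mem_iff.1 hy with rfl | rfl <;> simp [h]

theorem exists_edgeCost_eq_metricCost {G : SimpleGraph V} (hG : G.Connected) (c : Sym2 V → ℝ≥0)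
    (e : Sym2 V) : ∃ B ⊆ G.edgeSet, (∀ u ∈ e, ∀ v ∈ e, contractMap B u = contractMap B v) ∧
      edgeCost c B = metricCost G c e := by
  have hne : {B | B ⊆ G.edgeSet ∧
      ∀ u ∈ e, ∀ v ∈ e, contractMap B u = contractMap B v}.Nonempty := by
    refine ⟨G.edgeSet, subset_rfl, fun u _ v _ => contractMap_eq_iff.2 ?_⟩
    rw [SimpleGraph.fromEdgeSet_edgeSet]
    exact hG.preconnected u v
  obtain ⟨B, hB, h⟩ := (hne.image (edgeCost c)).csInf_mem (Set.toFinite _)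
  exact ⟨B, hB.1, hB.2, h⟩

theorem metricCost_triangle {G : SimpleGraph V} (hG : G.Connected) (c : Sym2 V → ℝ≥0)
    (u v w : V) : metricCost G c s(u, w) ≤ metricCost G c s(u, v) + metricCost G c s(v, w) := by
  obtain ⟨B, hB, hBuv, hBc⟩ := exists_edgeCost_eq_metricCost hG c s(u, v)
  obtain ⟨B', hB', hBvw, hBc'⟩ := exists_edgeCost_eq_metricCost hG c s(v, w)
  rw [← hBc, ← hBc']
  refine (metricCost_le c (Set.union_subset hB hB') ?_).trans (edgeCost_union_le c B B')
  exact (contractMap_mono Set.subset_union_left (hBuv u (by simp) v (by simp))).trans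
    (contractMap_mono Set.subset_union_right (hBvw v (by simp) w (by simp)))

theorem metricCost_le_of_mem {G : SimpleGraph V} (c : Sym2 V → ℝ≥0) {e : Sym2 V}
    (he : e ∈ G.edgeSet) : metricCost G c e ≤ c e := by
  rw [← edgeCost_singleton c e]
  induction e using Sym2.ind with | _ u v
  exact metricCost_le c (Set.singleton_subset_iff.2 he) (contractMap_eq_of_mem rfl)

/-- Replacing edges by shortest paths. -/
theorem exists_expansion {G : SimpleGraph V} (hG : G.Connected) (c : Sym2 V → ℝ≥0)
    (A : Set (Sym2 V)) : ∃ B ⊆ G.edgeSet,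
      (∀ u v, contractMap A u = contractMap A v → contractMap B u = contractMap B v) ∧
      edgeCost c B ≤ edgeCost (metricCost G c) A := by
  induction A, A.toFinite using Set.Finite.induction_on with
  | empty => exact ⟨∅, Set.empty_subset _, fun _ _ h => h, by simp⟩
  | @insert e A he hA ih =>
    obtain ⟨B, hB, hAB, hcost⟩ := ih
    obtain ⟨B', hB', he', hcost'⟩ := exists_edgeCost_eq_metricCost hG c e
    refine ⟨B' ∪ B, Set.union_subset hB' hB, fun u v huv => ?_, ?_⟩
    · refine apply_eq_of_contractMap_eq _ (fun x y hxy => ?_) huv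
      rcases hxy with hxy | hxy
      · rw [← hxy] at he'
        exact contractMap_mono Set.subset_union_left (he' x (by simp) y (by simp))
      · exact contractMap_mono Set.subset_union_right (hAB x y (contractMap_eq_of_mem hxy))
    · rw [edgeCost_insert _ he, ← hcost']
      exact (edgeCost_union_le c B' B).trans (by gcongr)

/-- The constraints involve neither the graph nor the costs. Full components of `G` persist in the
complete graph and are no dearer there, so each hyperedge cost can only fall. -/
theorem partitionOpt_metricCost_le [DecidableEq V] (G : SimpleGraph V) (c : Sym2 V → ℝ≥0)
    (R : Finset V) : partitionOpt ⊤ (metricCost G c) R ≤ partitionOpt G c R := by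
  refine iInf₂_mono fun x _ => Finset.sum_le_sum fun K _ => mul_le_mul_left ?_ _
  refine le_iInf₂ fun H hH => ?_
  obtain ⟨H', hH', hedge⟩ := hH.map_top
  refine (iInf₂_le H' hH').trans ?_
  rw [hedge]
  exact_mod_cast edgeCost_mono_cost fun e he => metricCost_le_of_mem c (H.edgeSet_subset he)

theorem exists_isMinFullComponent {G : SimpleGraph V} (c : Sym2 V → ℝ≥0) {R K : Finset V}
    (h : ∃ H, IsFullComponent G R K H) : ∃ H, IsMinFullComponent G c R K H := by
  obtain ⟨H, hH, hmin⟩ := (Set.toFinite {H | IsFullComponent G R K H}).exists_minimalFor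
    (fun H => edgeCost c H.edgeSet) _ h
  exact ⟨H, hH, fun H' hH' => (le_total _ _).elim id fun h => hmin hH' h⟩

end MetricClosure

end SteinerTree

theorem mainTheorem10 {V : Type*} [Fintype V] [DecidableEq V]
    (R : Finset V) (hR : R.Nonempty) (c : Sym2 V → ℝ≥0) :
    -- the heuristic, on the complete graph with metric costs
    ((∀ u v w : V, c s(u, w) ≤ c s(u, v) + c s(v, w)) →
      ∀ (F : Finset V → (⊤ : SimpleGraph V).Subgraph) (L : List (Finset V)),
        -- `F K` is the fixed minimum-cost full component of each `K` that has a full component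
        (∀ K, (∃ H, SteinerTree.IsFullComponent ⊤ R K H) →
          SteinerTree.IsMinFullComponent ⊤ c R K (F K)) →
        -- `L` lists these `K` in an arbitrary order
        L.Nodup → (∀ K, K ∈ L ↔ ∃ H, SteinerTree.IsFullComponent ⊤ R K H) →
        (∃ A, SteinerTree.IsHeuristicOutput ⊤ c R F L A) ∧
        ∀ A, SteinerTree.IsHeuristicOutput ⊤ c R F L A →
          (∃ H : (⊤ : SimpleGraph V).Subgraph,
            H.Connected ∧ (R : Set V) ⊆ H.verts ∧ H.edgeSet = A) ∧
          (∃ S : (⊤ : SimpleGraph V).Subgraph,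
            SteinerTree.IsSteinerTree ⊤ R S ∧ S.edgeSet ⊆ A) ∧
          (SteinerTree.edgeCost c A : ℝ≥0∞) ≤
            ENNReal.ofReal (2 * √2 - 1) * SteinerTree.partitionOpt ⊤ c R) ∧
    -- the integrality gap, on arbitrary connected graphs with arbitrary nonnegative costs
    (∀ G : SimpleGraph V, G.Connected →
      SteinerTree.steinerOpt G c R ≤
        ENNReal.ofReal (2 * √2 - 1) * SteinerTree.partitionOpt G c R) := by
  classical
  refine ⟨fun hc F L hF _ hL =>
    ⟨SteinerTree.exists_isHeuristicOutput hR F L, fun A hA => ?_⟩, fun G hG => ?_⟩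
  · obtain ⟨hA1, hA2, hA3, hcost⟩ := hA.spec hR hc hF hL
    refine ⟨?_, SteinerTree.exists_isSteinerTree hR hA1 hA2, hcost⟩
    obtain ⟨r, hr⟩ := hR
    refine ⟨SteinerTree.componentSubgraph ⊤ A r, SteinerTree.componentSubgraph_connected hA1 r,
      fun v hv => hA2 v hv r hr, SteinerTree.edgeSet_componentSubgraph hA1 fun e he v hv => ?_⟩
    obtain ⟨x, hx, hxv⟩ := hA3 e he v hv
    exact hxv.symm.trans (hA2 x hx r hr)
  -- The heuristic is run on the metric closure. Its output is expanded into shortest paths of `G`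
  -- and pruned to a Steiner tree; `⊥` is a dummy for sets without a full component.
  · let d := SteinerTree.metricCost G c
    let F : Finset V → (⊤ : SimpleGraph V).Subgraph := fun K =>
      if h : ∃ H, SteinerTree.IsFullComponent ⊤ R K H then
        (SteinerTree.exists_isMinFullComponent d h).choose else ⊥
    have hF : ∀ K, (∃ H, SteinerTree.IsFullComponent ⊤ R K H) →
        SteinerTree.IsMinFullComponent ⊤ d R K (F K) := by
      intro K hK
      simp only [F, dif_pos hK]
      exact (SteinerTree.exists_isMinFullComponent d hK).choose_spec
    let L : List (Finset V) :=
      (Finset.univ.filter fun K => ∃ H, SteinerTree.IsFullComponent ⊤ R K H).toList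
    obtain ⟨A, hA⟩ := SteinerTree.exists_isHeuristicOutput (c := d) hR F L
    obtain ⟨-, hA2, -, hcost⟩ :=
      hA.spec hR (SteinerTree.metricCost_triangle hG c) hF (by simp [L])
    obtain ⟨B, hB, hAB, hBc⟩ := SteinerTree.exists_expansion hG c A
    obtain ⟨S, hS, hSB⟩ := SteinerTree.exists_isSteinerTree hR hB
      fun u hu v hv => hAB u v (hA2 u hu v hv)
    calc SteinerTree.steinerOpt G c R ≤ SteinerTree.edgeCost c S.edgeSet := iInf₂_le S hS
      _ ≤ SteinerTree.edgeCost d A := by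
        exact_mod_cast (SteinerTree.edgeCost_mono c hSB).trans hBc
      _ ≤ ENNReal.ofReal (2 * √2 - 1) * SteinerTree.partitionOpt ⊤ d R := hcost
      _ ≤ _ := by
        gcongr
        exact SteinerTree.partitionOpt_metricCost_le G c R
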